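/- Let $R$ be a commutative ring, $\delta\in R$ and $n\ge 0$. The Brauer algebra $\mathrm{Br}_n=\mathrm{Br}_n(R,\delta)$ is the $R$-algebra that is free as an $R$-module on the diagrams, i.e. the perfect matchings of $\{-n,\dots,-1\}\cup\{1,\dots,n\}$ (negative nodes on the left, positive nodes on the right); the product $b_1b_2$ of two diagrams is obtained by pasting $b_1$ to the left of $b_2$, deleting the closed loops in the middle and multiplying by $\delta$ once for each of them. A diagram in which every left node is joined to a right node is called a permutation diagram; these correspond to the elements of the symmetric group $\mathfrak S_n$. Let $\iota\colon R\mathfrak S_n\to \mathrm{Br}_n$ be the $R$-algebra homomorphism that sends a permutation to its diagram, and $\pi\colon \mathrm{Br}_n\to R\mathfrak S_n$ the $R$-algebra homomorphism that sends a permutation diagram to its permutation and every other diagram to $0$. Let $\mathbb 1$ be the trivial (left and right) module: it is $R$ as an $R$-module, permutations and permutation diagrams act on it as the identity, and all other diagrams act as $0$. The homology of $\mathfrak S_n$ is $H_*(\mathfrak S_n;\mathbb 1)=\mathrm{Tor}_*^{R\mathfrak S_n}(\mathbb 1,\mathbb 1)$, and the homology of $\mathrm{Br}_n$ is $\mathrm{Tor}_*^{\mathrm{Br}_n}(\mathbb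 1,\mathbb 1)$. Theorem A. Suppose that $\delta$ is invertible in $R$. Then in every degree $i\ge 0$ the $R$-linear maps induced by $\iota$ and $\pi$ (together with the identity map of $\mathbb 1$), $$\mathrm{Tor}_i^{R\mathfrak S_n}(\mathbb 1,\mathbb 1)\xrightarrow{\ \iota_*\ }\mathrm{Tor}_i^{\mathrm{Br}_n(R,\delta)}(\mathbb 1,\mathbb 1)\xrightarrow{\ \pi_*\ }\mathrm{Tor}_i^{R\mathfrak S_n}(\mathbb 1,\mathbb 1),$$ are mutually inverse isomorphisms. In particular $\mathrm{Tor}_*^{\mathrm{Br}_n(R,\delta)}(\mathbb 1,\mathbb 1)\cong H_*(\mathfrak S_n;\mathbb 1)$. -/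

import Mathlib

set_option linter.unusedSectionVars false

namespace BrauerHomology

/-- A perfect matching of `α ⊔ β`: an equivalence relation all of whose classes have exactly two
elements. It is drawn as a diagram with the nodes of `α` on the left, those of `β` on the right. -/
@[ext]
structure Diagram (α β : Type) where
  /-- Two nodes are related if they are equal or joined by an arc. -/
  rel : Setoid (α ⊕ β)
  pairs : ∀ x, ∃! y, y ≠ x ∧ rel x y

namespace Diagram

variable {α β γ ε : Type}

theorem eq_of_le {b c : Diagram α β} (h : ∀ x y, b.rel x y → c.rel x y) : b = c := by
  ext x y
  refine ⟨h x y, fun hc => ?_⟩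
  by_cases hxy : y = x
  · subst hxy; exact b.rel.refl _
  obtain ⟨z, ⟨hz, hbz⟩, -⟩ := b.pairs x
  obtain ⟨w, -, hw⟩ := c.pairs x
  have h1 := hw z ⟨hz, h _ _ hbz⟩
  have h2 := hw y ⟨hxy, hc⟩
  rw [h2, ← h1]; exact hbz

/-- The other end of the arc at `x`. -/
noncomputable def partner (b : Diagram α β) (x : α ⊕ β) : α ⊕ β := (b.pairs x).choose

theorem partner_ne (b : Diagram α β) (x : α ⊕ β) : b.partner x ≠ x :=
  (b.pairs x).choose_spec.1.1

theorem rel_partner (b : Diagram α β) (x : α ⊕ β) : b.rel x (b.partner x) :=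
  (b.pairs x).choose_spec.1.2

theorem eq_partner (b : Diagram α β) {x y : α ⊕ β} (h : b.rel x y) (hy : y ≠ x) :
    y = b.partner x :=
  (b.pairs x).choose_spec.2 y ⟨hy, h⟩

theorem partner_partner (b : Diagram α β) (x : α ⊕ β) : b.partner (b.partner x) = x :=
  (b.eq_partner (b.rel.symm (b.rel_partner x)) (b.partner_ne x).symm).symm

/-- Pasting `b` to the left of `c`: the connected components of the union of the arcs of `b` and
of `c`, on the left nodes `α`, the middle nodes `β` and the right nodes `γ`. -/
def glue (b : Diagram α β) (c : Diagram β γ) : Setoid (α ⊕ β ⊕ γ) :=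
  b.rel.map (Sum.map id Sum.inl) ⊔ c.rel.map Sum.inr

/-- The number of closed loops that arise when `b` is pasted to the left of `c`: the components
that consist of middle nodes only. -/
noncomputable def loops (b : Diagram α β) (c : Diagram β γ) : ℕ :=
  {C ∈ (glue b c).classes | C ⊆ Set.range (Sum.inr ∘ Sum.inl)}.ncard

theorem glue_left (b : Diagram α β) (c : Diagram β γ) {x y : α ⊕ β} (h : b.rel x y) :
    glue b c (Sum.map id Sum.inl x) (Sum.map id Sum.inl y) :=
  (le_sup_left : b.rel.map (Sum.map id Sum.inl) ≤ glue b c) (Setoid.le_comap_map h)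

theorem glue_right (b : Diagram α β) (c : Diagram β γ) {x y : β ⊕ γ} (h : c.rel x y) :
    glue b c (Sum.inr x) (Sum.inr y) :=
  (le_sup_right : c.rel.map Sum.inr ≤ glue b c) (Setoid.le_comap_map h)

theorem map_le {X Y : Type} {r : Setoid X} {f : X → Y} {t : Setoid Y}
    (h : ∀ x y, r x y → t (f x) (f y)) : r.map f ≤ t := by
  refine Setoid.eqvGen_le ?_
  rintro _ _ ⟨x, y, hxy, rfl, rfl⟩
  exact h x y hxy

theorem glue_le {b : Diagram α β} {c : Diagram β γ} {t : Setoid (α ⊕ β ⊕ γ)}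
    (hb : ∀ x y, b.rel x y → t (Sum.map id Sum.inl x) (Sum.map id Sum.inl y))
    (hc : ∀ x y, c.rel x y → t (Sum.inr x) (Sum.inr y)) : glue b c ≤ t :=
  sup_le (map_le hb) (map_le hc)

/-- A finite component of the union of two partial matchings without common free vertices contains,
with one free vertex, exactly one other one. -/
theorem exists_unique_end {V : Type} [Finite V] {a c : V → V} (ha : ∀ v, a (a v) = v)
    (hc : ∀ v, c (c v) = v) (hne : ∀ v, ¬(a v = v ∧ c v = v)) (s : Setoid V)
    (hsa : ∀ v, s v (a v)) (hsc : ∀ v, s v (c v))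
    (hmin : ∀ S : Set V, (∀ v ∈ S, a v ∈ S) → (∀ v ∈ S, c v ∈ S) → ∀ u v, s u v → u ∈ S → v ∈ S)
    (x : V) (hx : c x = x) :
    ∃! y, y ≠ x ∧ s x y ∧ (a y = y ∨ c y = y) := by
  classical
  let w : ℕ → V := fun k => Nat.rec x (fun k v => if Even k then a v else c v) k
  have w0 : w 0 = x := rfl
  have we : ∀ k, Even k → w (k + 1) = a (w k) := fun k hk => by simp [w, hk]
  have wo : ∀ k, ¬ Even k → w (k + 1) = c (w k) := fun k hk => by simp [w, hk]
  have hsw : ∀ k, s x (w k) := by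
    intro k
    induction k with
    | zero => exact s.refl _
    | succ k ih =>
      by_cases hk : Even k
      · rw [we k hk]; exact s.trans ih (hsa _)
      · rw [wo k hk]; exact s.trans ih (hsc _)
  -- the walk ends somewhere
  have hfix : ∃ k, w (k + 1) = w k := by
    let pa : Equiv.Perm V := ⟨a, a, ha, ha⟩
    let pc : Equiv.Perm V := ⟨c, c, hc, hc⟩
    have hp : ∀ k, w (2 * k) = ((pc * pa) ^ k) x := by
      intro k
      induction k with
      | zero => rfl
      | succ k ih =>
        have h1 : w (2 * k + 1) = a (w (2 * k)) := we _ (by simp)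
        have h2 : w (2 * k + 1 + 1) = c (w (2 * k + 1)) := wo _ (by simp)
        rw [pow_succ', show 2 * (k + 1) = 2 * k + 1 + 1 by ring, h2, h1, ih]
        rfl
    obtain ⟨N, hN, hpN⟩ := (isOfFinOrder_of_finite (pc * pa)).exists_pow_eq_one
    have h1 : w (2 * N) = x := by rw [hp, hpN]; rfl
    refine ⟨2 * N - 1, ?_⟩
    have h2 : w (2 * N - 1 + 1) = c (w (2 * N - 1)) := wo _ (by
      rw [Nat.not_even_iff_odd]; exact ⟨N - 1, by omega⟩)
    have h3 : 2 * N - 1 + 1 = 2 * N := by omega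
    have h4 : c (w (2 * N)) = w (2 * N - 1) := by
      have h5 := congrArg c h2
      rwa [hc, h3] at h5
    rw [h3, h1, ← h4, h1, hx]
  obtain ⟨K, hK, hlt⟩ : ∃ K, w (K + 1) = w K ∧ ∀ k, k < K → w (k + 1) ≠ w k := by
    classical
    exact ⟨Nat.find hfix, Nat.find_spec hfix, fun k hk => Nat.find_min hfix hk⟩
  have hK0 : 0 < K := by
    rcases Nat.eq_zero_or_pos K with h | h
    · exfalso
      rw [h, we 0 (by simp), w0] at hK
      exact hne x ⟨hK, hx⟩
    · exact h
  have back_e : ∀ k, Even k → a (w (k + 1)) = w k := fun k hk => by rw [we k hk, ha]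
  have back_o : ∀ k, ¬ Even k → c (w (k + 1)) = w k := fun k hk => by rw [wo k hk, hc]
  -- the image of a step
  have stepa : ∀ k, k ≤ K → ∃ j ≤ K, a (w k) = w j := by
    intro k hk
    by_cases hev : Even k
    · rcases hk.lt_or_eq with h | h
      · exact ⟨k + 1, h, (we k hev).symm⟩
      · exact ⟨k, h.le, by rw [← we k hev, h, hK]⟩
    · obtain ⟨j, rfl⟩ : ∃ j, k = j + 1 := ⟨k - 1, by
        rcases k with _ | k
        · simp at hev
        · rfl⟩
      have hj : Even j := by
        by_contra h; exact hev (Nat.even_add_one.2 h)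
      exact ⟨j, by omega, back_e j hj⟩
  have stepc : ∀ k, k ≤ K → ∃ j ≤ K, c (w k) = w j := by
    intro k hk
    by_cases hev : Even k
    · rcases k with _ | j
      · exact ⟨0, by omega, by rw [w0, hx]⟩
      · have hj : ¬ Even j := Nat.even_add_one.1 hev
        exact ⟨j, by omega, back_o j hj⟩
    · rcases hk.lt_or_eq with h | h
      · exact ⟨k + 1, h, (wo k hev).symm⟩
      · exact ⟨k, h.le, by rw [← wo k hev, h, hK]⟩
  have hall : ∀ v, s x v → ∃ k ≤ K, v = w k := by
    intro v hv
    refine hmin {v | ∃ k ≤ K, v = w k} ?_ ?_ x v hv ⟨0, by omega, rfl⟩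
    · rintro _ ⟨k, hk, rfl⟩; exact stepa k hk
    · rintro _ ⟨k, hk, rfl⟩; exact stepc k hk
  -- interior vertices are not free
  have hint : ∀ k, k + 1 < K → ¬(a (w (k + 1)) = w (k + 1) ∨ c (w (k + 1)) = w (k + 1)) := by
    rintro k hk (h | h)
    · by_cases hev : Even k
      · rw [back_e k hev] at h; exact hlt k (by omega) h.symm
      · have h2 : Even (k + 1) := Nat.even_add_one.2 hev
        rw [← we _ h2] at h; exact hlt (k + 1) hk h
    · by_cases hev : Even k
      · have h2 : ¬ Even (k + 1) := fun h3 => Nat.even_add_one.1 h3 hev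
        rw [← wo _ h2] at h; exact hlt (k + 1) hk h
      · rw [back_o k hev] at h; exact hlt k (by omega) h.symm
  have hend : a (w K) = w K ∨ c (w K) = w K := by
    by_cases hev : Even K
    · left; rw [← we K hev, hK]
    · right; rw [← wo K hev, hK]
  have hne' : w K ≠ x := by
    intro hKx
    have hodd : ¬ Even K := by
      intro hev
      refine hne x ⟨?_, hx⟩
      have := hK
      rwa [we K hev, hKx] at this
    obtain ⟨m, hm⟩ := Nat.not_even_iff_odd.1 hodd
    have hpal : ∀ i, i ≤ K → w (K - i) = w i := by
      intro i
      induction i with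
      | zero => intro _; exact hKx
      | succ i ih =>
        intro hi
        have h1 := ih (by omega)
        have h2 : K - i = (K - (i + 1)) + 1 := by omega
        by_cases hev : Even i
        · have h3 : Even (K - (i + 1)) := by
            obtain ⟨t, ht⟩ := hev
            exact ⟨m - t, by omega⟩
          rw [we i hev, ← h1, h2, back_e _ h3]
        · have h3 : ¬ Even (K - (i + 1)) := by
            obtain ⟨t, ht⟩ := Nat.not_even_iff_odd.1 hev
            rw [Nat.not_even_iff_odd]
            exact ⟨m - t - 1, by omega⟩
          rw [wo i hev, ← h1, h2, back_o _ h3]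
    have h1 := hpal m (by omega)
    rw [show K - m = m + 1 by omega] at h1
    exact hlt m (by omega) h1
  refine ⟨w K, ⟨hne', hsw K, hend⟩, ?_⟩
  rintro y ⟨hyx, hsy, hy⟩
  obtain ⟨k, hk, rfl⟩ := hall y hsy
  rcases hk.lt_or_eq with h | h
  · rcases k with _ | k
    · exact absurd w0 hyx
    · exact absurd hy (hint k h)
  · rw [h]

section comp

variable (b : Diagram α β) (c : Diagram β γ)

/-- The arcs of `b` as an involution of all nodes. -/
noncomputable def leftMove : α ⊕ β ⊕ γ → α ⊕ β ⊕ γ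
  | .inl x => Sum.map id Sum.inl (b.partner (.inl x))
  | .inr (.inl y) => Sum.map id Sum.inl (b.partner (.inr y))
  | .inr (.inr z) => .inr (.inr z)

/-- The arcs of `c` as an involution of all nodes. -/
noncomputable def rightMove : α ⊕ β ⊕ γ → α ⊕ β ⊕ γ
  | .inl x => .inl x
  | .inr y => .inr (c.partner y)

theorem leftMove_map (x : α ⊕ β) :
    leftMove (γ := γ) b (Sum.map id Sum.inl x) = Sum.map id Sum.inl (b.partner x) := by
  rcases x with x | x <;> rfl

theorem leftMove_leftMove (v : α ⊕ β ⊕ γ) : leftMove b (leftMove b v) = v := by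
  rcases v with x | y | z
  · exact (leftMove_map b _).trans (by rw [partner_partner]; rfl)
  · exact (leftMove_map b _).trans (by rw [partner_partner]; rfl)
  · rfl

theorem rightMove_rightMove (v : α ⊕ β ⊕ γ) : rightMove c (rightMove c v) = v := by
  rcases v with x | y
  · rfl
  · simp [rightMove, partner_partner]

theorem injective_inl : Function.Injective (Sum.map id Sum.inl : α ⊕ β → α ⊕ β ⊕ γ) :=
  Function.Injective.sumMap Function.injective_id Sum.inl_injective

theorem injective_ends : Function.Injective (Sum.map id Sum.inr : α ⊕ γ → α ⊕ β ⊕ γ) :=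
  Function.Injective.sumMap Function.injective_id Sum.inr_injective

theorem leftMove_eq_iff (v : α ⊕ β ⊕ γ) : leftMove b v = v ↔ ∃ z, v = .inr (.inr z) := by
  have key : ∀ x : α ⊕ β, leftMove (γ := γ) b (Sum.map id Sum.inl x) ≠ Sum.map id Sum.inl x := by
    intro x h
    rw [leftMove_map] at h
    exact b.partner_ne x (injective_inl h)
  rcases v with x | y | z
  · simpa using key (.inl x)
  · simpa using key (.inr y)
  · simp [leftMove]

theorem rightMove_eq_iff (v : α ⊕ β ⊕ γ) : rightMove c v = v ↔ ∃ z, v = .inl z := by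
  rcases v with x | y
  · simp [rightMove]
  · simpa [rightMove] using c.partner_ne y

theorem glue_leftMove (v : α ⊕ β ⊕ γ) : glue b c v (leftMove b v) := by
  rcases v with x | y | z
  · exact glue_left b c (b.rel_partner (.inl x))
  · exact glue_left b c (b.rel_partner (.inr y))
  · exact (glue b c).refl _

theorem glue_rightMove (v : α ⊕ β ⊕ γ) : glue b c v (rightMove c v) := by
  rcases v with x | y
  · exact (glue b c).refl _
  · exact glue_right b c (c.rel_partner y)

theorem glue_min (S : Set (α ⊕ β ⊕ γ)) (ha : ∀ v ∈ S, leftMove b v ∈ S)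
    (hc : ∀ v ∈ S, rightMove c v ∈ S) (u v : α ⊕ β ⊕ γ) (h : glue b c u v) (hu : u ∈ S) :
    v ∈ S := by
  have hle : glue b c ≤ Setoid.ker (fun v => v ∈ S) := by
    refine glue_le (fun x y hxy => ?_) (fun x y hxy => ?_)
    · rw [Setoid.ker_def]
      by_cases hyx : y = x
      · rw [hyx]
      · rw [b.eq_partner hxy hyx, ← leftMove_map]
        refine propext ⟨ha _, fun h => ?_⟩
        have := ha _ h
        rwa [leftMove_leftMove] at this
    · rw [Setoid.ker_def]
      by_cases hyx : y = x
      · rw [hyx]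
      · rw [c.eq_partner hxy hyx]
        refine propext ⟨hc (.inr x), fun h => ?_⟩
        have := hc _ h
        simpa [rightMove, partner_partner] using this
  have := hle h
  rw [Setoid.ker_def] at this
  exact this ▸ hu

/-- The diagram `b c` without its scalar factor: left and right nodes are joined if they lie in the
same component of the pasted diagram. -/
def comp [Finite α] [Finite β] [Finite γ] : Diagram α γ where
  rel := (glue b c).comap (Sum.map id Sum.inr)
  pairs := by
    have main : ∀ v : α ⊕ β ⊕ γ, (∃ x : α ⊕ γ, v = Sum.map id Sum.inr x) →
        ∃! y, y ≠ v ∧ glue b c v y ∧ (leftMove b y = y ∨ rightMove c y = y) := by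
      have hne : ∀ v : α ⊕ β ⊕ γ, ¬(leftMove b v = v ∧ rightMove c v = v) := by
        rintro v ⟨h1, h2⟩
        obtain ⟨z, rfl⟩ := (leftMove_eq_iff b v).1 h1
        obtain ⟨z', h⟩ := (rightMove_eq_iff c _).1 h2
        cases h
      rintro v ⟨x | z, rfl⟩
      · exact exists_unique_end (leftMove_leftMove b) (rightMove_rightMove c) hne (glue b c)
          (glue_leftMove b c) (glue_rightMove b c) (glue_min b c) _ rfl
      · have := exists_unique_end (rightMove_rightMove c) (leftMove_leftMove b)
          (fun v hv => hne v hv.symm) (glue b c)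
          (glue_rightMove b c) (glue_leftMove b c) (fun S h1 h2 => glue_min b c S h2 h1)
          (.inr (.inr z)) rfl
        simp only [or_comm (a := rightMove c _ = _)] at this
        exact this
    intro x
    obtain ⟨y, ⟨hy, hxy, he⟩, hu⟩ := main _ ⟨x, rfl⟩
    have hy' : ∃ y' : α ⊕ γ, y = Sum.map id Sum.inr y' := by
      rcases he with he | he
      · obtain ⟨z, rfl⟩ := (leftMove_eq_iff b y).1 he
        exact ⟨.inr z, rfl⟩
      · obtain ⟨z, rfl⟩ := (rightMove_eq_iff c y).1 he
        exact ⟨.inl z, rfl⟩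
    obtain ⟨y', rfl⟩ := hy'
    refine ⟨y', ⟨fun h => hy (by rw [h]), hxy⟩, ?_⟩
    rintro z ⟨hz, hxz⟩
    refine injective_ends (hu _ ⟨fun h => hz (injective_ends h), hxz, ?_⟩)
    rcases z with z | z
    · right; rfl
    · left; rfl

end comp

section assoc

variable {U V W : Type}

theorem map_rel {X Y : Type} {r : Setoid X} {f : X → Y} {x y : X} (h : r x y) :
    (r.map f) (f x) (f y) := Setoid.le_comap_map h

theorem map_sup {X Y : Type} (r s : Setoid X) (f : X → Y) :
    (r ⊔ s).map f = r.map f ⊔ s.map f := by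
  refine le_antisymm (map_le ?_) (sup_le (map_le ?_) (map_le ?_))
  · have : r ⊔ s ≤ (r.map f ⊔ s.map f).comap f :=
      sup_le (fun x y h => (le_sup_left : r.map f ≤ _) (map_rel h))
        (fun x y h => (le_sup_right : s.map f ≤ _) (map_rel h))
    exact fun x y h => this h
  · exact fun x y h => map_rel ((le_sup_left : r ≤ r ⊔ s) h)
  · exact fun x y h => map_rel ((le_sup_right : s ≤ r ⊔ s) h)

theorem map_map {X Y Z : Type} (r : Setoid X) (f : X → Y) (g : Y → Z) :
    (r.map f).map g = r.map (g ∘ f) := by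
  refine le_antisymm (map_le ?_) (map_le ?_)
  · have : r.map f ≤ (r.map (g ∘ f)).comap g := map_le fun x y h => map_rel (f := g ∘ f) h
    exact fun x y h => this h
  · exact fun x y h => map_rel (map_rel h)

theorem map_iff {X Y : Type} {r : Setoid X} {f : X → Y} (hf : Function.Injective f) {u v : Y} :
    (r.map f) u v ↔ u = v ∨ ∃ x y, f x = u ∧ f y = v ∧ r x y := by
  constructor
  · intro h
    let t : Setoid Y :=
      { r := fun u v => u = v ∨ ∃ x y, f x = u ∧ f y = v ∧ r x y
        iseqv := by
          refine ⟨fun _ => .inl rfl, ?_, ?_⟩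
          · rintro _ _ (rfl | ⟨x, y, rfl, rfl, h⟩)
            · exact .inl rfl
            · exact .inr ⟨y, x, rfl, rfl, r.symm h⟩
          · rintro _ _ _ (rfl | ⟨x, y, rfl, rfl, h⟩) (rfl | ⟨x', y', hx', rfl, h'⟩)
            · exact .inl rfl
            · exact .inr ⟨x', y', hx', rfl, h'⟩
            · exact .inr ⟨x, y, rfl, rfl, h⟩
            · rw [hf hx'] at h'
              exact .inr ⟨x, y', rfl, rfl, r.trans h h'⟩ }
    have : r.map f ≤ t := map_le fun x y h => .inr ⟨x, y, rfl, rfl, h⟩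
    exact this h
  · rintro (rfl | ⟨x, y, rfl, rfl, h⟩)
    · exact (r.map f).refl _
    · exact map_rel h

theorem comap_map_square {X : Type} {g : Setoid U} {i : W → V} {j : U → V} {k : X → U}
    {m : X → W} (hi : Function.Injective i) (hj : Function.Injective j)
    (hm : Function.Injective m)
    (hsq : ∀ x, i (m x) = j (k x)) (hpb : ∀ w u, i w = j u → ∃ x, w = m x ∧ u = k x) :
    (g.map j).comap i = (g.comap k).map m := by
  ext w w'
  rw [Setoid.comap_rel, map_iff hj, map_iff hm]
  constructor
  · rintro (h | ⟨u, u', hu, hu', h⟩)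
    · exact .inl (hi h)
    · obtain ⟨x, rfl, rfl⟩ := hpb _ _ hu.symm
      obtain ⟨x', rfl, rfl⟩ := hpb _ _ hu'.symm
      exact .inr ⟨x, x', rfl, rfl, h⟩
  · rintro (rfl | ⟨x, x', rfl, rfl, h⟩)
    · exact .inl rfl
    · exact .inr ⟨k x, k x', (hsq x).symm, (hsq x').symm, h⟩

theorem sup_map_iff {s : Setoid V} {i : W → V} {r : Setoid W} {u v : V} :
    (s ⊔ r.map i) u v ↔
      s u v ∨ ∃ w w', s u (i w) ∧ (s.comap i ⊔ r) w w' ∧ s (i w') v := by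
  constructor
  · intro h
    let t : Setoid V :=
      { r := fun u v => s u v ∨ ∃ w w', s u (i w) ∧ (s.comap i ⊔ r) w w' ∧ s (i w') v
        iseqv := by
          refine ⟨fun _ => .inl (s.refl _), ?_, ?_⟩
          · rintro u v (h | ⟨w, w', h1, h2, h3⟩)
            · exact .inl (s.symm h)
            · exact .inr ⟨w', w, s.symm h3, Setoid.symm' _ h2, s.symm h1⟩
          · rintro u v z (h | ⟨w, w', h1, h2, h3⟩) (h' | ⟨y, y', h1', h2', h3'⟩)
            · exact .inl (s.trans h h')
            · exact .inr ⟨y, y', s.trans h h1', h2', h3'⟩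
            · exact .inr ⟨w, w', h1, h2, s.trans h3 h'⟩
            · have : s.comap i w' y := s.trans h3 h1'
              exact .inr ⟨w, y', h1, Setoid.trans' _ (Setoid.trans' _ h2
                ((le_sup_left : s.comap i ≤ s.comap i ⊔ r) this)) h2', h3'⟩ }
    have : s ⊔ r.map i ≤ t :=
      sup_le (fun _ _ h => .inl h) (map_le fun x y h => .inr ⟨x, y, s.refl _,
        (le_sup_right : r ≤ s.comap i ⊔ r) h, s.refl _⟩)
    exact this h
  · have hs : s ≤ s ⊔ r.map i := le_sup_left
    have hr : s.comap i ⊔ r ≤ (s ⊔ r.map i).comap i :=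
      sup_le (fun x y h => hs h) (fun x y h => (le_sup_right : r.map i ≤ _) (map_rel h))
    rintro (h | ⟨w, w', h1, h2, h3⟩)
    · exact hs h
    · exact Setoid.trans' _ (hs h1) (Setoid.trans' _ (hr h2) (hs h3))

theorem comap_sup_map {s : Setoid V} {i : W → V} {r : Setoid W} :
    (s ⊔ r.map i).comap i = s.comap i ⊔ r := by
  ext w w'
  rw [Setoid.comap_rel, sup_map_iff]
  constructor
  · rintro (h | ⟨x, x', h1, h2, h3⟩)
    · exact (le_sup_left : s.comap i ≤ s.comap i ⊔ r) h
    · exact Setoid.trans' _ ((le_sup_left : s.comap i ≤ s.comap i ⊔ r) h1) (Setoid.trans' _ h2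
        ((le_sup_left : s.comap i ≤ s.comap i ⊔ r) h3))
  · intro h
    exact .inr ⟨w, w', s.refl _, h, s.refl _⟩

theorem ncard_classes [Finite V] {s : Setoid V} {i : W → V}
    {r : Setoid W} {E : Set V} (hE : E ⊆ Set.range i) :
    {C ∈ (s ⊔ r.map i).classes | C ⊆ Eᶜ}.ncard =
      {C ∈ s.classes | C ⊆ (Set.range i)ᶜ}.ncard +
      {C ∈ (s.comap i ⊔ r).classes | C ⊆ (i ⁻¹' E)ᶜ}.ncard := by
  set t := s ⊔ r.map i with ht
  have h1 : {C ∈ t.classes | C ⊆ Eᶜ} = {C ∈ s.classes | C ⊆ (Set.range i)ᶜ} ∪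
      {C ∈ t.classes | C ⊆ Eᶜ ∧ (C ∩ Set.range i).Nonempty} := by
    have hst : s ≤ t := le_sup_left
    ext C
    constructor
    · rintro ⟨⟨u, rfl⟩, hC⟩
      by_cases hne : ({x | t x u} ∩ Set.range i).Nonempty
      · exact .inr ⟨⟨u, rfl⟩, hC, hne⟩
      · refine .inl ⟨⟨u, ?_⟩, fun x hx hx' => hne ⟨x, hx, hx'⟩⟩
        ext x
        refine ⟨fun hx => ?_, fun hx => hst hx⟩
        rcases sup_map_iff.1 hx with h | ⟨w, w', h1, h2, h3⟩
        · exact h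
        · exact absurd ⟨i w', hst h3, w', rfl⟩ hne
    · rintro (⟨⟨u, rfl⟩, hC⟩ | ⟨hC, hC', -⟩)
      · refine ⟨⟨u, ?_⟩, fun x hx hx' => hC hx (hE hx')⟩
        ext x
        refine ⟨fun hx => hst hx, fun hx => ?_⟩
        rcases sup_map_iff.1 hx with h | ⟨w, w', h1, h2, h3⟩
        · exact h
        · exact absurd ⟨w', rfl⟩ (hC h3)
      · exact ⟨hC, hC'⟩
  have h2 : {C ∈ (s.comap i ⊔ r).classes | C ⊆ (i ⁻¹' E)ᶜ} =
      (fun C => i ⁻¹' C) '' {C ∈ t.classes | C ⊆ Eᶜ ∧ (C ∩ Set.range i).Nonempty} := by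
    rw [← comap_sup_map, ← ht]
    ext D
    constructor
    · rintro ⟨⟨w, rfl⟩, hD⟩
      refine ⟨{x | t x (i w)}, ⟨⟨_, rfl⟩, fun x hx hxE => ?_, ⟨i w, t.refl _, w, rfl⟩⟩, rfl⟩
      obtain ⟨w', rfl⟩ := hE hxE
      exact hD (show t (i w') (i w) from hx) hxE
    · rintro ⟨C, ⟨⟨u, rfl⟩, hC, ⟨_, hx, w, rfl⟩⟩, rfl⟩
      refine ⟨⟨w, ?_⟩, fun y hy => hC hy⟩
      ext y
      exact ⟨fun h => t.trans h (t.symm hx), fun h => t.trans h hx⟩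
  rw [h1, h2, Set.InjOn.ncard_image, Set.ncard_union_eq]
  · rw [Set.disjoint_left]
    rintro C ⟨-, hC⟩ ⟨-, -, ⟨x, hx, hx'⟩⟩
    exact hC hx hx'
  · rintro C ⟨⟨u, rfl⟩, -, ⟨_, hx, w, rfl⟩⟩ C' ⟨⟨u', rfl⟩, -, -⟩ h
    have hw : w ∈ i ⁻¹' {x | t x u'} := by
      rw [← show i ⁻¹' {x | t x u} = i ⁻¹' {x | t x u'} from h]; exact hx
    have huu' : t u u' := t.trans (t.symm hx) hw
    ext x
    exact ⟨fun h => t.trans h huu', fun h => t.trans h (t.symm huu')⟩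

theorem ncard_classes_map {g : Setoid U} {j : U → V} (hj : Function.Injective j) {F : Set V}
    (hF : Fᶜ ⊆ Set.range j) :
    {C ∈ (g.map j).classes | C ⊆ Fᶜ}.ncard = {C ∈ g.classes | C ⊆ (j ⁻¹' F)ᶜ}.ncard := by
  rw [← Set.ncard_image_of_injective _ (Set.image_injective.2 hj)]
  congr 1
  ext C
  constructor
  · rintro ⟨⟨u, rfl⟩, hC⟩
    obtain ⟨u, rfl⟩ := hF (hC (Setoid.refl' (g.map j) u))
    refine ⟨{x | g x u}, ⟨⟨u, rfl⟩, fun x hx => hC (map_rel hx)⟩, ?_⟩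
    ext v
    constructor
    · rintro ⟨x, hx, rfl⟩; exact map_rel hx
    · intro hv
      rcases (map_iff hj).1 hv with rfl | ⟨x, y, rfl, hy, h⟩
      · exact ⟨u, g.refl _, rfl⟩
      · rw [hj hy] at h; exact ⟨x, h, rfl⟩
  · rintro ⟨D, ⟨⟨u, rfl⟩, hD⟩, rfl⟩
    refine ⟨⟨j u, ?_⟩, ?_⟩
    · ext v
      constructor
      · rintro ⟨x, hx, rfl⟩; exact map_rel hx
      · intro hv
        rcases (map_iff hj).1 hv with rfl | ⟨x, y, rfl, hy, h⟩
        · exact ⟨u, g.refl _, rfl⟩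
        · rw [hj hy] at h; exact ⟨x, h, rfl⟩
    · rintro _ ⟨x, hx, rfl⟩; exact hD hx

theorem loops_eq (b : Diagram α β) (c : Diagram β γ) {F : Set (α ⊕ β ⊕ γ)}
    (hF : ∀ v, v ∈ F ↔ ∀ y, v ≠ .inr (.inl y)) :
    loops b c = {C ∈ (glue b c).classes | C ⊆ Fᶜ}.ncard := by
  have : Set.range (Sum.inr ∘ Sum.inl : β → α ⊕ β ⊕ γ) = Fᶜ := by
    ext v
    simp only [Set.mem_range, Function.comp_apply, Set.mem_compl_iff, hF]
    push Not
    exact ⟨fun ⟨y, h⟩ => ⟨y, h.symm⟩, fun ⟨y, h⟩ => ⟨y, h.symm⟩⟩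
  rw [loops, this]

variable (b : Diagram α β) (c : Diagram β γ) (d : Diagram γ ε)

/-- Three diagrams pasted next to each other. -/
def glue₃ : Setoid (α ⊕ β ⊕ γ ⊕ ε) :=
  b.rel.map (Sum.map id Sum.inl) ⊔ c.rel.map (Sum.inr ∘ Sum.map id Sum.inl) ⊔
    d.rel.map (Sum.inr ∘ Sum.inr)

theorem glue₃_left : glue₃ b c d = (glue b c).map (Sum.map id (Sum.map id Sum.inl)) ⊔
    (d.rel.map Sum.inr).map (Sum.map id Sum.inr) := by
  rw [glue₃, glue, map_sup, map_map, map_map, map_map]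
  congr 3
  funext x
  rcases x with x | x <;> rfl

theorem glue₃_right : glue₃ b c d = (glue c d).map Sum.inr ⊔
    (b.rel.map (Sum.map id Sum.inl)).map (Sum.map id (Sum.map id Sum.inr)) := by
  rw [glue₃, glue, map_sup, map_map, map_map, map_map, sup_comm _ (b.rel.map _), sup_assoc]
  congr 2
  funext x
  rcases x with x | x <;> rfl

variable [Finite α] [Finite β] [Finite γ] [Finite ε]

theorem glue_comp_left : glue (comp b c) d =
    ((glue b c).map (Sum.map id (Sum.map id Sum.inl))).comap (Sum.map id Sum.inr) ⊔
      d.rel.map Sum.inr := by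
  rw [comap_map_square (k := Sum.map id Sum.inr) (m := Sum.map id Sum.inl)]
  · rfl
  · exact injective_ends
  · exact Function.injective_id.sumMap (Function.injective_id.sumMap Sum.inl_injective)
  · exact injective_inl
  · rintro (x | x) <;> rfl
  · rintro (w | w | w) (u | u | u) h <;> simp at h
    · exact ⟨.inl w, rfl, by simp [h]⟩
    · exact ⟨.inr w, rfl, by simp [h]⟩

theorem glue_comp_right : glue b (comp c d) =
    ((glue c d).map Sum.inr).comap (Sum.map id (Sum.map id Sum.inr)) ⊔
      b.rel.map (Sum.map id Sum.inl) := by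
  rw [comap_map_square (k := Sum.map id Sum.inr) (m := Sum.inr), sup_comm]
  · rfl
  · exact Function.injective_id.sumMap (Function.injective_id.sumMap Sum.inr_injective)
  · exact Sum.inr_injective
  · exact Sum.inr_injective
  · rintro (x | x) <;> rfl
  · rintro (w | w | w) (u | u | u) h <;> simp at h
    · exact ⟨.inl w, rfl, by simp [h]⟩
    · exact ⟨.inr w, rfl, by simp [h]⟩

theorem comp_assoc : comp (comp b c) d = comp b (comp c d) := by
  have h1 : glue (comp b c) d = (glue₃ b c d).comap (Sum.map id Sum.inr) := by
    rw [glue_comp_left, glue₃_left, comap_sup_map]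
  have h2 : glue b (comp c d) = (glue₃ b c d).comap (Sum.map id (Sum.map id Sum.inr)) := by
    rw [glue_comp_right, glue₃_right, comap_sup_map]
  ext x y
  change glue (comp b c) d _ _ ↔ glue b (comp c d) _ _
  rw [h1, h2]
  rcases x with x | x <;> rcases y with y | y <;> rfl

theorem loops_assoc :
    loops b c + loops (comp b c) d = loops c d + loops b (comp c d) := by
  let E : Set (α ⊕ β ⊕ γ ⊕ ε) := {v | (∃ x, v = .inl x) ∨ ∃ x, v = .inr (.inr (.inr x))}
  have h1 : {C ∈ (glue₃ b c d).classes | C ⊆ Eᶜ}.ncard = loops b c + loops (comp b c) d := by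
    rw [glue₃_left, ncard_classes, ncard_classes_map, ← glue_comp_left, ← loops_eq, ← loops_eq]
    · rintro (v | v | v) <;> simp [E]
    · rintro (v | v | v) <;> simp
    · exact Function.injective_id.sumMap (Function.injective_id.sumMap Sum.inl_injective)
    · rintro (v | v | v | v) <;> simp
    · rintro (v | v | v | v) <;> simp [E]
  have h2 : {C ∈ (glue₃ b c d).classes | C ⊆ Eᶜ}.ncard = loops c d + loops b (comp c d) := by
    rw [glue₃_right, ncard_classes, ncard_classes_map, ← glue_comp_right, ← loops_eq, ← loops_eq]
    · rintro (v | v | v) <;> simp [E]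
    · rintro (v | v | v) <;> simp
    · exact Sum.inr_injective
    · rintro (v | v | v | v) <;> simp
    · rintro (v | v | v | v) <;> simp [E]
  rw [← h1, h2]

end assoc

end Diagram
end BrauerHomology

namespace BrauerHomology

namespace Diagram

section perm

variable {α β γ : Type}

/-- The diagram of a permutation: the right node `j` is joined to the left node `σ j`. -/
def ofPerm (σ : Equiv.Perm α) : Diagram α α where
  rel := Setoid.ker (Sum.elim id σ)
  pairs := by
    rintro (x | x)
    · refine ⟨.inr (σ.symm x), ⟨by simp, by simp [Setoid.ker_def]⟩, ?_⟩
      rintro (y | y) ⟨hy, h⟩ <;> rw [Setoid.ker_def] at h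
      · exact absurd (congrArg Sum.inl h.symm) hy
      · exact congrArg Sum.inr (σ.eq_symm_apply.2 h.symm)
    · refine ⟨.inl (σ x), ⟨by simp, by simp [Setoid.ker_def]⟩, ?_⟩
      rintro (y | y) ⟨hy, h⟩ <;> rw [Setoid.ker_def] at h
      · exact congrArg Sum.inl h.symm
      · exact absurd (congrArg Sum.inr (σ.injective h.symm)) hy

theorem ofPerm_rel (σ : Equiv.Perm α) (y : α) : (ofPerm σ).rel (.inl (σ y)) (.inr y) :=
  rfl

/-- A permutation diagram: every node on the left is joined to a node on the right. -/
def IsPermutation (b : Diagram α β) : Prop := ∀ x, ∃ y, b.rel (.inl x) (.inr y)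

theorem ofPerm_isPermutation (σ : Equiv.Perm α) : (ofPerm σ).IsPermutation := fun x =>
  ⟨σ.symm x, by simpa using ofPerm_rel σ (σ.symm x)⟩

theorem rel_unique (b : Diagram α β) {x y z : α ⊕ β} (hy : b.rel x y) (hz : b.rel x z)
    (hyx : y ≠ x) (hzx : z ≠ x) : y = z :=
  (b.eq_partner hy hyx).trans (b.eq_partner hz hzx).symm

variable [Finite α]

theorem isPermutation_iff_right (b : Diagram α α) :
    b.IsPermutation ↔ ∀ y, ∃ x, b.rel (.inl x) (.inr y) := by
  constructor
  · intro h
    choose f hf using h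
    have hinj : Function.Injective f := by
      intro x x' hxx
      by_contra hne
      have h1 := b.rel_unique (b.rel.symm (hf x)) (hxx ▸ b.rel.symm (hf x')) (by simp) (by simp)
      exact hne (by simpa using h1)
    intro y
    obtain ⟨x, rfl⟩ := Finite.injective_iff_surjective.1 hinj y
    exact ⟨x, hf x⟩
  · intro h
    choose f hf using h
    have hinj : Function.Injective f := by
      intro x x' hxx
      by_contra hne
      have h1 := b.rel_unique (hf x) (hxx ▸ hf x') (by simp) (by simp)
      exact hne (by simpa using h1)
    intro x
    obtain ⟨y, rfl⟩ := Finite.injective_iff_surjective.1 hinj x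
    exact ⟨y, hf y⟩

theorem exists_perm {b : Diagram α α} (h : b.IsPermutation) : ∃ σ, ofPerm σ = b := by
  choose g hg using (isPermutation_iff_right b).1 h
  have hinj : Function.Injective g := by
    intro x x' hxx
    by_contra hne
    have h1 := b.rel_unique (hg x) (hxx ▸ hg x') (by simp) (by simp)
    exact hne (by simpa using h1)
  have hbij : Function.Bijective g := ⟨hinj, Finite.injective_iff_surjective.1 hinj⟩
  have key : ∀ x, b.rel (.inl (Sum.elim id g x)) x := by
    rintro (x | y)
    · exact b.rel.refl _
    · exact hg y
  refine ⟨Equiv.ofBijective g hbij, eq_of_le fun x y hxy => ?_⟩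
  have hxy' : Sum.elim id g x = Sum.elim id g y := hxy
  exact b.rel.trans (b.rel.symm (key x)) (hxy' ▸ key y)

/-- The permutation of a permutation diagram. -/
noncomputable def toPerm (b : Diagram α α) (h : b.IsPermutation) : Equiv.Perm α :=
  (exists_perm h).choose

theorem ofPerm_toPerm (b : Diagram α α) (h : b.IsPermutation) : ofPerm (b.toPerm h) = b :=
  (exists_perm h).choose_spec

theorem ofPerm_injective : Function.Injective (ofPerm : Equiv.Perm α → Diagram α α) := by
  intro σ τ h
  ext y
  have h1 := ofPerm_rel σ y
  rw [h] at h1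
  exact h1

theorem toPerm_ofPerm (σ : Equiv.Perm α) (h : (ofPerm σ).IsPermutation) :
    (ofPerm σ).toPerm h = σ := ofPerm_injective (ofPerm_toPerm _ h)

variable [Finite β] [Finite γ]

theorem comp_rel_left (b : Diagram α β) (c : Diagram β γ) {x x' : α}
    (h : b.rel (.inl x) (.inl x')) : (comp b c).rel (.inl x) (.inl x') :=
  glue_left b c h

theorem comp_rel_right (b : Diagram α β) (c : Diagram β γ) {z z' : γ}
    (h : c.rel (.inr z) (.inr z')) : (comp b c).rel (.inr z) (.inr z') :=
  glue_right b c h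

theorem comp_rel_through (b : Diagram α β) (c : Diagram β γ) {x : α} {y : β} {z : γ}
    (hb : b.rel (.inl x) (.inr y)) (hc : c.rel (.inl y) (.inr z)) :
    (comp b c).rel (.inl x) (.inr z) :=
  (glue b c).trans (glue_left b c hb) (glue_right b c hc)

theorem ofPerm_comp_ofPerm (σ τ : Equiv.Perm α) :
    comp (ofPerm σ) (ofPerm τ) = ofPerm (σ * τ) := by
  symm
  have key : ∀ x, (comp (ofPerm σ) (ofPerm τ)).rel (.inl (Sum.elim id (σ * τ) x)) x := by
    rintro (x | y)
    · exact Setoid.refl' _ _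
    · exact comp_rel_through _ _ (ofPerm_rel σ (τ y)) (ofPerm_rel τ y)
  refine eq_of_le fun x y hxy => ?_
  have hxy' : Sum.elim id (σ * τ) x = Sum.elim id (σ * τ) y := hxy
  exact Setoid.trans' _ (Setoid.symm' _ (key x)) (hxy' ▸ key y)

theorem one_comp (c : Diagram α β) : comp (ofPerm 1) c = c := by
  symm
  have key : ∀ x, glue (ofPerm 1) c (Sum.map id Sum.inr x) (.inr x) := by
    rintro (x | y)
    · exact glue_left (ofPerm 1) c (ofPerm_rel 1 x)
    · exact Setoid.refl' _ _
  refine eq_of_le fun x y hxy => ?_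
  exact (glue _ c).trans (key x) ((glue _ c).trans (glue_right _ c hxy) ((glue _ c).symm (key y)))

theorem comp_one (b : Diagram β α) : comp b (ofPerm 1) = b := by
  symm
  have key : ∀ x, glue b (ofPerm 1) (Sum.map id Sum.inr x) (Sum.map id Sum.inl x) := by
    rintro (x | y)
    · exact Setoid.refl' _ _
    · exact Setoid.symm' _ (glue_right b (ofPerm 1) (ofPerm_rel 1 y))
  refine eq_of_le fun x y hxy => ?_
  exact (glue b _).trans (key x) ((glue b _).trans (glue_left b _ hxy) ((glue b _).symm (key y)))

theorem loops_of_isPermutation_left {b : Diagram α α} (hb : b.IsPermutation) (c : Diagram α γ) :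
    loops b c = 0 := by
  rw [loops, Set.ncard_eq_zero]
  rw [Set.eq_empty_iff_forall_notMem]
  rintro _ ⟨⟨u, rfl⟩, hC⟩
  obtain ⟨y, rfl⟩ := hC (Setoid.refl' (glue b c) u)
  obtain ⟨x, hx⟩ := (isPermutation_iff_right b).1 hb y
  obtain ⟨y', hy'⟩ := hC (show (Sum.inl x) ∈ _ from glue_left b c hx)
  cases hy'

theorem loops_of_isPermutation_right (b : Diagram α β) {c : Diagram β γ} (hc : c.IsPermutation) :
    loops b c = 0 := by
  rw [loops, Set.ncard_eq_zero]
  rw [Set.eq_empty_iff_forall_notMem]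
  rintro _ ⟨⟨u, rfl⟩, hC⟩
  obtain ⟨y, rfl⟩ := hC (Setoid.refl' (glue b c) u)
  obtain ⟨z, hz⟩ := hc y
  obtain ⟨y', hy'⟩ := hC (show (Sum.inr (Sum.inr z)) ∈ _ from
    Setoid.symm' _ (glue_right b c hz))
  cases hy'

theorem isPermutation_comp (b c : Diagram α α) :
    (comp b c).IsPermutation ↔ b.IsPermutation ∧ c.IsPermutation := by
  constructor
  · intro h
    constructor
    · intro x
      rcases hp : b.partner (.inl x) with x' | y
      · exfalso
        have h1 : b.rel (.inl x) (.inl x') := hp ▸ b.rel_partner _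
        have h2 : Sum.inl x' ≠ Sum.inl x := hp ▸ b.partner_ne _
        obtain ⟨z, hz⟩ := h x
        have := (comp b c).rel_unique (comp_rel_left b c h1) hz (by simpa using h2) (by simp)
        simp at this
      · exact ⟨y, hp ▸ b.rel_partner _⟩
    · rw [isPermutation_iff_right] at h ⊢
      intro z
      rcases hp : c.partner (.inr z) with y | z'
      · exact ⟨y, c.rel.symm (hp ▸ c.rel_partner _)⟩
      · exfalso
        have h1 : c.rel (.inr z) (.inr z') := hp ▸ c.rel_partner _
        have h2 : Sum.inr z' ≠ Sum.inr z := hp ▸ c.partner_ne _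
        obtain ⟨x, hx⟩ := h z
        have := (comp b c).rel_unique (comp_rel_right b c h1) (Setoid.symm' _ hx)
          (by simpa using h2) (by simp)
        simp at this
  · rintro ⟨hb, hc⟩ x
    obtain ⟨y, hy⟩ := hb x
    obtain ⟨z, hz⟩ := hc y
    exact ⟨z, comp_rel_through b c hy hz⟩

end perm

end Diagram

universe u

/-- The Brauer algebra `Br_n(R, δ)`: the free `R`-module on the diagrams with `n` nodes on either
side, where the product of two diagrams is `δ ^ loops` times their composite. -/
def BrauerAlgebra (R : Type u) [CommRing R] (_δ : R) (n : ℕ) : Type u :=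
  Diagram (Fin n) (Fin n) →₀ R

namespace BrauerAlgebra

variable {R : Type u} [CommRing R] {δ : R} {n : ℕ}

noncomputable instance instAddCommGroup : AddCommGroup (BrauerAlgebra R δ n) :=
  inferInstanceAs (AddCommGroup (Diagram (Fin n) (Fin n) →₀ R))

noncomputable instance : Module R (BrauerAlgebra R δ n) :=
  inferInstanceAs (Module R (Diagram (Fin n) (Fin n) →₀ R))

variable (R δ n) in
/-- The diagrams form a basis of the Brauer algebra. -/
noncomputable def basis : Module.Basis (Diagram (Fin n) (Fin n)) R (BrauerAlgebra R δ n) :=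
  Module.Basis.ofRepr (LinearEquiv.refl R (Diagram (Fin n) (Fin n) →₀ R))

variable (δ) in
/-- A diagram as an element of the Brauer algebra. -/
noncomputable def diag (b : Diagram (Fin n) (Fin n)) : BrauerAlgebra R δ n := basis R δ n b

theorem hom_ext {M : Type*} [AddCommMonoid M] [Module R M] {f g : BrauerAlgebra R δ n →ₗ[R] M}
    (h : ∀ b, f (diag δ b) = g (diag δ b)) : f = g :=
  (basis R δ n).ext h

variable (R δ n) in
/-- The multiplication of the Brauer algebra as a bilinear map. -/
noncomputable def mulBilin :
    BrauerAlgebra R δ n →ₗ[R] BrauerAlgebra R δ n →ₗ[R] BrauerAlgebra R δ n :=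
  (basis R δ n).constr R fun b => (basis R δ n).constr R fun c =>
    δ ^ Diagram.loops b c • diag δ (Diagram.comp b c)

noncomputable instance : Mul (BrauerAlgebra R δ n) := ⟨fun x y => mulBilin R δ n x y⟩

noncomputable instance : One (BrauerAlgebra R δ n) := ⟨diag δ (Diagram.ofPerm 1)⟩

theorem mul_def (x y : BrauerAlgebra R δ n) : x * y = mulBilin R δ n x y := rfl

theorem one_def : (1 : BrauerAlgebra R δ n) = diag δ (Diagram.ofPerm 1) := rfl

theorem diag_mul_diag (b c : Diagram (Fin n) (Fin n)) :
    (diag δ b * diag δ c : BrauerAlgebra R δ n) =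
      δ ^ Diagram.loops b c • diag δ (Diagram.comp b c) := by
  rw [mul_def, mulBilin, diag, diag, Module.Basis.constr_basis, Module.Basis.constr_basis]

@[elab_as_elim]
theorem induction {p : BrauerAlgebra R δ n → Prop} (hd : ∀ b, p (diag δ b))
    (ha : ∀ x y, p x → p y → p (x + y)) (hs : ∀ (r : R) x, p x → p (r • x))
    (x : BrauerAlgebra R δ n) : p x := by
  have hx := (basis R δ n).mem_span x
  induction hx using Submodule.span_induction with
  | mem x h => obtain ⟨b, rfl⟩ := h; exact hd b
  | zero => simpa using hs 0 _ (hd (Diagram.ofPerm 1))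
  | add x y _ _ hx hy => exact ha x y hx hy
  | smul r x _ hx => exact hs r x hx

theorem add_mul_aux (x y z : BrauerAlgebra R δ n) : (x + y) * z = x * z + y * z := by
  simp only [mul_def, map_add, LinearMap.add_apply]

theorem mul_add_aux (x y z : BrauerAlgebra R δ n) : x * (y + z) = x * y + x * z := by
  simp only [mul_def, map_add]

theorem smul_mul_aux (r : R) (x y : BrauerAlgebra R δ n) : r • x * y = r • (x * y) := by
  simp only [mul_def, map_smul, LinearMap.smul_apply]

theorem mul_smul_aux (r : R) (x y : BrauerAlgebra R δ n) : x * r • y = r • (x * y) := by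
  simp only [mul_def, map_smul]

theorem mul_assoc_aux (x y z : BrauerAlgebra R δ n) : x * y * z = x * (y * z) := by
  induction x using induction with
  | ha x x' h h' => simp only [add_mul_aux, h, h']
  | hs r x h => simp only [smul_mul_aux, h]
  | hd b =>
    induction y using induction with
    | ha x x' h h' => simp only [add_mul_aux, mul_add_aux, h, h']
    | hs r x h => simp only [smul_mul_aux, mul_smul_aux, h]
    | hd c =>
      induction z using induction with
      | ha x x' h h' => simp only [mul_add_aux, h, h']
      | hs r x h => simp only [mul_smul_aux, h]
      | hd d =>
        rw [diag_mul_diag, diag_mul_diag, smul_mul_aux, mul_smul_aux, diag_mul_diag,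
          diag_mul_diag, smul_smul, smul_smul, ← pow_add, ← pow_add, Diagram.comp_assoc,
          Diagram.loops_assoc]

theorem one_mul_aux (x : BrauerAlgebra R δ n) : 1 * x = x := by
  induction x using induction with
  | ha x x' h h' => simp only [mul_add_aux, h, h']
  | hs r x h => simp only [mul_smul_aux, h]
  | hd b =>
    rw [one_def, diag_mul_diag, Diagram.one_comp,
      Diagram.loops_of_isPermutation_left (Diagram.ofPerm_isPermutation 1), pow_zero, one_smul]

theorem mul_one_aux (x : BrauerAlgebra R δ n) : x * 1 = x := by
  induction x using induction with
  | ha x x' h h' => simp only [add_mul_aux, h, h']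
  | hs r x h => simp only [smul_mul_aux, h]
  | hd b =>
    rw [one_def, diag_mul_diag, Diagram.comp_one,
      Diagram.loops_of_isPermutation_right _ (Diagram.ofPerm_isPermutation 1), pow_zero, one_smul]

noncomputable instance : Ring (BrauerAlgebra R δ n) where
  __ := (instAddCommGroup : AddCommGroup (BrauerAlgebra R δ n))
  left_distrib := mul_add_aux
  right_distrib := add_mul_aux
  zero_mul x := by simp only [mul_def, map_zero, LinearMap.zero_apply]
  mul_zero x := by simp only [mul_def, map_zero]
  mul_assoc := mul_assoc_aux
  one_mul := one_mul_aux
  mul_one := mul_one_aux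

noncomputable instance : Algebra R (BrauerAlgebra R δ n) :=
  Algebra.ofModule smul_mul_aux mul_smul_aux

end BrauerAlgebra

section maps

variable (R : Type u) [CommRing R] (δ : R) (n : ℕ)

/-- The inclusion of the group algebra of the symmetric group into the Brauer algebra: a
permutation is sent to its diagram. -/
noncomputable def incl : MonoidAlgebra R (Equiv.Perm (Fin n)) →ₐ[R] BrauerAlgebra R δ n :=
  MonoidAlgebra.lift R (BrauerAlgebra R δ n) (Equiv.Perm (Fin n))
    { toFun := fun σ => BrauerAlgebra.diag δ (Diagram.ofPerm σ)
      map_one' := rfl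
      map_mul' := fun σ τ => by
        rw [BrauerAlgebra.diag_mul_diag, Diagram.ofPerm_comp_ofPerm,
          Diagram.loops_of_isPermutation_left (Diagram.ofPerm_isPermutation σ), pow_zero,
          one_smul] }

theorem incl_single (σ : Equiv.Perm (Fin n)) :
    incl R δ n (MonoidAlgebra.single σ 1) = BrauerAlgebra.diag δ (Diagram.ofPerm σ) := by
  rw [incl, MonoidAlgebra.lift_single, one_smul]
  rfl

open Classical in
/-- The projection on diagrams: a permutation diagram is sent to its permutation, every other
diagram to zero. -/
noncomputable def projDiagram (b : Diagram (Fin n) (Fin n)) :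
    MonoidAlgebra R (Equiv.Perm (Fin n)) :=
  if h : b.IsPermutation then MonoidAlgebra.single (b.toPerm h) 1 else 0

theorem projDiagram_ofPerm (σ : Equiv.Perm (Fin n)) :
    projDiagram R n (Diagram.ofPerm σ) = MonoidAlgebra.single σ 1 := by
  rw [projDiagram, dif_pos (Diagram.ofPerm_isPermutation σ), Diagram.toPerm_ofPerm]

theorem projDiagram_comp (b c : Diagram (Fin n) (Fin n)) :
    δ ^ Diagram.loops b c • projDiagram R n (Diagram.comp b c) =
      projDiagram R n b * projDiagram R n c := by
  by_cases hb : b.IsPermutation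
  · by_cases hc : c.IsPermutation
    · obtain ⟨σ, rfl⟩ := Diagram.exists_perm hb
      obtain ⟨τ, rfl⟩ := Diagram.exists_perm hc
      rw [Diagram.loops_of_isPermutation_left hb, Diagram.ofPerm_comp_ofPerm, projDiagram_ofPerm,
        projDiagram_ofPerm, projDiagram_ofPerm, MonoidAlgebra.single_mul_single, one_mul, pow_zero,
        one_smul]
    · have h : ¬ (Diagram.comp b c).IsPermutation := fun h =>
        hc ((Diagram.isPermutation_comp b c).1 h).2
      rw [projDiagram, dif_neg h, projDiagram, projDiagram, dif_neg hc, mul_zero, smul_zero]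
  · have h : ¬ (Diagram.comp b c).IsPermutation := fun h =>
      hb ((Diagram.isPermutation_comp b c).1 h).1
    rw [projDiagram, dif_neg h, projDiagram, dif_neg hb, zero_mul, smul_zero]

/-- An algebra homomorphism from the Brauer algebra, given on the basis of diagrams. -/
noncomputable def algHomOfDiagram {B : Type u} [Ring B] [Algebra R B]
    (f : Diagram (Fin n) (Fin n) → B) (h1 : f (Diagram.ofPerm 1) = 1)
    (hmul : ∀ b c, δ ^ Diagram.loops b c • f (Diagram.comp b c) = f b * f c) :
    BrauerAlgebra R δ n →ₐ[R] B :=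
  AlgHom.ofLinearMap ((BrauerAlgebra.basis R δ n).constr R f)
    (by rw [BrauerAlgebra.one_def, BrauerAlgebra.diag, Module.Basis.constr_basis, h1])
    (by
      intro x y
      induction x using BrauerAlgebra.induction with
      | ha x x' h h' => rw [add_mul, map_add, map_add, h, h', add_mul]
      | hs r x h => rw [smul_mul_assoc, map_smul, map_smul, h, smul_mul_assoc]
      | hd b =>
        induction y using BrauerAlgebra.induction with
        | ha x x' h h' => rw [mul_add, map_add, map_add, h, h', mul_add]
        | hs r x h => rw [mul_smul_comm, map_smul, map_smul, h, mul_smul_comm]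
        | hd c =>
          rw [BrauerAlgebra.diag_mul_diag, map_smul, BrauerAlgebra.diag, BrauerAlgebra.diag,
            BrauerAlgebra.diag, Module.Basis.constr_basis, Module.Basis.constr_basis,
            Module.Basis.constr_basis, hmul])

theorem algHomOfDiagram_diag {B : Type u} [Ring B] [Algebra R B]
    (f : Diagram (Fin n) (Fin n) → B) (h1 : f (Diagram.ofPerm 1) = 1)
    (hmul : ∀ b c, δ ^ Diagram.loops b c • f (Diagram.comp b c) = f b * f c)
    (b : Diagram (Fin n) (Fin n)) :
    algHomOfDiagram R δ n f h1 hmul (BrauerAlgebra.diag δ b) = f b :=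
  (BrauerAlgebra.basis R δ n).constr_basis R f b

/-- The projection of the Brauer algebra onto the group algebra of the symmetric group. -/
noncomputable def proj : BrauerAlgebra R δ n →ₐ[R] MonoidAlgebra R (Equiv.Perm (Fin n)) :=
  algHomOfDiagram R δ n (projDiagram R n) (projDiagram_ofPerm R n 1) (projDiagram_comp R δ n)

theorem proj_diag (b : Diagram (Fin n) (Fin n)) :
    proj R δ n (BrauerAlgebra.diag δ b) = projDiagram R n b :=
  algHomOfDiagram_diag R δ n _ _ _ b

/-- The action of the group algebra on the trivial module: permutations act as the identity. -/
noncomputable def symmAug : MonoidAlgebra R (Equiv.Perm (Fin n)) →ₐ[R] R :=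
  MonoidAlgebra.lift R R (Equiv.Perm (Fin n)) 1

theorem symmAug_single (σ : Equiv.Perm (Fin n)) (r : R) :
    symmAug R n (MonoidAlgebra.single σ r) = r := by
  rw [symmAug, MonoidAlgebra.lift_single, MonoidHom.one_apply, smul_eq_mul, mul_one]

open Classical in
/-- The action of the Brauer algebra on the trivial module: permutation diagrams act as the
identity, all other diagrams act as zero. -/
noncomputable def brauerAug : BrauerAlgebra R δ n →ₐ[R] R :=
  algHomOfDiagram R δ n (fun b => if b.IsPermutation then 1 else 0)
    (if_pos (Diagram.ofPerm_isPermutation 1))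
    (by
      intro b c
      by_cases hb : b.IsPermutation
      · by_cases hc : c.IsPermutation
        · rw [if_pos ((Diagram.isPermutation_comp b c).2 ⟨hb, hc⟩), if_pos hb, if_pos hc,
            Diagram.loops_of_isPermutation_left hb, pow_zero, one_smul, one_mul]
        · rw [if_neg fun h => hc ((Diagram.isPermutation_comp b c).1 h).2, if_neg hc, mul_zero,
            smul_zero]
      · rw [if_neg fun h => hb ((Diagram.isPermutation_comp b c).1 h).1, if_neg hb, zero_mul,
          smul_zero])

open Classical in
theorem brauerAug_diag (b : Diagram (Fin n) (Fin n)) :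
    brauerAug R δ n (BrauerAlgebra.diag δ b) = if b.IsPermutation then 1 else 0 :=
  algHomOfDiagram_diag R δ n _ _ _ b

theorem brauerAug_comp_incl : (brauerAug R δ n).comp (incl R δ n) = symmAug R n := by
  refine MonoidAlgebra.algHom_ext (fun σ => ?_) (Subsingleton.elim _ _)
  rw [AlgHom.comp_apply, incl_single, brauerAug_diag, if_pos (Diagram.ofPerm_isPermutation σ),
    symmAug_single]

theorem symmAug_comp_proj : (symmAug R n).comp (proj R δ n) = brauerAug R δ n := by
  apply AlgHom.toLinearMap_injective
  refine BrauerAlgebra.hom_ext fun b => ?_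
  change symmAug R n (proj R δ n _) = brauerAug R δ n _
  rw [proj_diag, brauerAug_diag, projDiagram]
  by_cases hb : b.IsPermutation
  · rw [dif_pos hb, if_pos hb, symmAug_single]
  · rw [dif_neg hb, if_neg hb, map_zero]

end maps

noncomputable section tensor

open TensorProduct MulOpposite CategoryTheory

variable {R : Type u} [CommRing R] (A : Type u) [Ring A] [Algebra R A]

/-- A right `A`-module (a left module over the opposite algebra), regarded as an `R`-module. -/
abbrev rightScalars (M : ModuleCat.{u} Aᵐᵒᵖ) : ModuleCat.{u} R :=
  (ModuleCat.restrictScalars (algebraMap R Aᵐᵒᵖ)).obj M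

/-- A left `A`-module, regarded as an `R`-module. -/
abbrev leftScalars (N : ModuleCat.{u} A) : ModuleCat.{u} R :=
  (ModuleCat.restrictScalars (algebraMap R A)).obj N

variable (R)

/-- The relations `(m a) ⊗ n = m ⊗ (a n)` in the tensor product over `R`. -/
def balanced (M : ModuleCat.{u} Aᵐᵒᵖ) (N : ModuleCat.{u} A) :
    Submodule R (rightScalars (R := R) A M ⊗[R] leftScalars (R := R) A N) :=
  Submodule.span R {z | ∃ (m : M) (a : A) (n : N),
    z = (show rightScalars (R := R) A M from op a • m) ⊗ₜ[R] (show leftScalars (R := R) A N from n)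
      - (show rightScalars (R := R) A M from m) ⊗ₜ[R] (show leftScalars (R := R) A N from a • n)}

/-- The tensor product `M ⊗_A N` of a right and a left `A`-module. -/
abbrev tensorObj (M : ModuleCat.{u} Aᵐᵒᵖ) (N : ModuleCat.{u} A) : ModuleCat.{u} R :=
  ModuleCat.of R ((rightScalars (R := R) A M ⊗[R] leftScalars (R := R) A N) ⧸ balanced R A M N)

/-- The pure tensor `m ⊗ n`. -/
def tmk {M : ModuleCat.{u} Aᵐᵒᵖ} {N : ModuleCat.{u} A} (m : M) (n : N) : tensorObj R A M N :=
  (balanced R A M N).mkQ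
    ((show rightScalars (R := R) A M from m) ⊗ₜ[R] (show leftScalars (R := R) A N from n))

theorem tensor_hom_ext {M : ModuleCat.{u} Aᵐᵒᵖ} {N : ModuleCat.{u} A} {X : ModuleCat.{u} R}
    {f g : tensorObj R A M N ⟶ X} (h : ∀ m n, f (tmk R A m n) = g (tmk R A m n)) : f = g := by
  apply ModuleCat.hom_ext
  apply Submodule.linearMap_qext
  apply TensorProduct.ext'
  exact h

variable {A}
variable {A' : Type u} [Ring A'] [Algebra R A'] (f : A →ₐ[R] A')

variable {R} in
/-- Restriction of right modules along an algebra homomorphism. -/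
abbrev resRight : ModuleCat.{u} A'ᵐᵒᵖ ⥤ ModuleCat.{u} Aᵐᵒᵖ :=
  ModuleCat.restrictScalars f.toRingHom.op

variable {R} in
/-- Restriction of left modules along an algebra homomorphism. -/
abbrev resLeft : ModuleCat.{u} A' ⥤ ModuleCat.{u} A :=
  ModuleCat.restrictScalars f.toRingHom

variable {R} in
/-- The map `M ⊗_A N → M' ⊗_A' N'`, `m ⊗ n ↦ g m ⊗ h n`, induced by maps `g` and `h` that are
semilinear over `f : A → A'`. -/
def tensorMap {M : ModuleCat.{u} Aᵐᵒᵖ} {N : ModuleCat.{u} A} {M' : ModuleCat.{u} A'ᵐᵒᵖ}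
    {N' : ModuleCat.{u} A'} (g : M ⟶ (resRight f).obj M') (h : N ⟶ (resLeft f).obj N') :
    tensorObj R A M N ⟶ tensorObj R A' M' N' :=
  ModuleCat.ofHom <| Submodule.mapQ (balanced R A M N) (balanced R A' M' N')
    (TensorProduct.map
      ({ toFun := fun m => g m
         map_add' := fun x y => map_add g.hom x y
         map_smul' := fun r x => by
          refine (g.hom.map_smul (algebraMap R Aᵐᵒᵖ r) x).trans ?_
          change op (f (algebraMap R A r)) • (show M' from g x) = op (algebraMap R A' r) • _
          rw [f.commutes] } :
        rightScalars (R := R) A M →ₗ[R] rightScalars (R := R) A' M')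
      ({ toFun := fun m => h m
         map_add' := fun x y => map_add h.hom x y
         map_smul' := fun r x => by
          refine (h.hom.map_smul (algebraMap R A r) x).trans ?_
          change f (algebraMap R A r) • (show N' from h x) = algebraMap R A' r • _
          rw [f.commutes] } :
        leftScalars (R := R) A N →ₗ[R] leftScalars (R := R) A' N'))
    (by
      rw [balanced, Submodule.span_le]
      rintro _ ⟨m, a, n, rfl⟩
      refine Submodule.subset_span ⟨g m, f a, h n, ?_⟩
      rw [map_sub, TensorProduct.map_tmul, TensorProduct.map_tmul]
      congr 2
      · exact g.hom.map_smul (op a) m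
      · exact h.hom.map_smul a n)

variable {R} in
theorem tensorMap_tmk {M : ModuleCat.{u} Aᵐᵒᵖ} {N : ModuleCat.{u} A} {M' : ModuleCat.{u} A'ᵐᵒᵖ}
    {N' : ModuleCat.{u} A'} (g : M ⟶ (resRight f).obj M') (h : N ⟶ (resLeft f).obj N')
    (m : M) (n : N) :
    tensorMap f g h (tmk R A m n) = tmk R A' (show M' from g m) (show N' from h n) :=
  rfl

variable (A)

/-- The functor `- ⊗_A N` from right `A`-modules to `R`-modules. -/
def tensorFunctor (N : ModuleCat.{u} A) : ModuleCat.{u} Aᵐᵒᵖ ⥤ ModuleCat.{u} R where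
  obj M := tensorObj R A M N
  map {M M'} g := ModuleCat.ofHom <| Submodule.mapQ (balanced R A M N) (balanced R A M' N)
    (LinearMap.rTensor (leftScalars (R := R) A N)
      ((ModuleCat.restrictScalars (algebraMap R Aᵐᵒᵖ)).map g).hom)
    (by
      rw [balanced, Submodule.span_le]
      rintro _ ⟨m, a, n, rfl⟩
      refine Submodule.subset_span ⟨g m, a, n, ?_⟩
      rw [map_sub, LinearMap.rTensor_tmul, LinearMap.rTensor_tmul]
      congr 2
      exact g.hom.map_smul (op a) m)
  map_id M := tensor_hom_ext R A fun m n => rfl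
  map_comp g h := tensor_hom_ext R A fun m n => rfl

theorem tensorFunctor_map_tmk (N : ModuleCat.{u} A) {M M' : ModuleCat.{u} Aᵐᵒᵖ} (g : M ⟶ M')
    (m : M) (n : N) : (tensorFunctor R A N).map g (tmk R A m n) = tmk R A (g m) n :=
  rfl

theorem tmk_add {M : ModuleCat.{u} Aᵐᵒᵖ} {N : ModuleCat.{u} A} (m m' : M) (n : N) :
    tmk R A (m + m') n = tmk R A m n + tmk R A m' n :=
  (congrArg (balanced R A M N).mkQ (TensorProduct.add_tmul _ _ _)).trans (map_add _ _ _)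

instance (N : ModuleCat.{u} A) : (tensorFunctor R A N).Additive where
  map_add {_ _ _ _} := tensor_hom_ext R A fun _ _ => tmk_add R A _ _ _

/-- The chain complex `P ⊗_A N`. -/
abbrev tensorComplex (P : ChainComplex (ModuleCat.{u} Aᵐᵒᵖ) ℕ) (N : ModuleCat.{u} A) :
    ChainComplex (ModuleCat.{u} R) ℕ :=
  ((tensorFunctor R A N).mapHomologicalComplex _).obj P

/-- `Tor_i^A(M, N)`, the homology of `P ⊗_A N` for a projective resolution `P` of `M`. -/
def Tor (M : ModuleCat.{u} Aᵐᵒᵖ) (N : ModuleCat.{u} A) (i : ℕ) : ModuleCat.{u} R :=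
  (tensorComplex R A (projectiveResolution M).complex N).homology i

variable {R A}

/-- The restriction of a complex of right modules along an algebra homomorphism. -/
abbrev resComplex (P : ChainComplex (ModuleCat.{u} A'ᵐᵒᵖ) ℕ) :
    ChainComplex (ModuleCat.{u} Aᵐᵒᵖ) ℕ :=
  ((resRight f).mapHomologicalComplex _).obj P

/-- The augmentation `P_0 → M` of a projective resolution. -/
def augmentation {M : ModuleCat.{u} Aᵐᵒᵖ} (P : ProjectiveResolution M) : P.complex.X 0 ⟶ M :=
  P.π.f 0

/-- A chain map `φ : P → P'` of complexes over `f : A → A'` lifts `g : M → M'` if it is compatible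
with the augmentations of the two resolutions. -/
def IsLift {M : ModuleCat.{u} Aᵐᵒᵖ} {M' : ModuleCat.{u} A'ᵐᵒᵖ} (g : M ⟶ (resRight f).obj M')
    (P : ProjectiveResolution M) (P' : ProjectiveResolution M')
    (φ : P.complex ⟶ resComplex f P'.complex) : Prop :=
  φ.f 0 ≫ (resRight f).map (augmentation P') = augmentation P ≫ g

theorem resRight_exact {S : ShortComplex (ModuleCat.{u} A'ᵐᵒᵖ)} (hS : S.Exact) :
    (S.map (resRight f)).Exact := by
  rw [ShortComplex.moduleCat_exact_iff] at hS ⊢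
  exact hS

/-- Lifts exist: restriction is exact, and the source is projective. -/
theorem exists_isLift {M : ModuleCat.{u} Aᵐᵒᵖ} {M' : ModuleCat.{u} A'ᵐᵒᵖ}
    (g : M ⟶ (resRight f).obj M') (P : ProjectiveResolution M) (P' : ProjectiveResolution M') :
    ∃ φ, IsLift f g P P' φ := by
  let p : (resRight f).obj (P'.complex.X 0) ⟶ (resRight f).obj M' := (resRight f).map (augmentation P')
  have hepi : Epi p := by
    rw [ModuleCat.epi_iff_surjective]
    exact (ModuleCat.epi_iff_surjective (P'.π.f 0)).1 inferInstance
  have hex0 := resRight_exact f P'.exact₀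
  have hex := fun n => resRight_exact f (P'.exact_succ n)
  let f0 : P.complex.X 0 ⟶ (resRight f).obj (P'.complex.X 0) :=
    Projective.factorThru (augmentation P ≫ g) p
  have h0 : f0 ≫ (resRight f).map (augmentation P') = augmentation P ≫ g :=
    Projective.factorThru_comp (augmentation P ≫ g) p
  have hz : (P.complex.d 1 0 ≫ f0) ≫ (resRight f).map (augmentation P') = 0 := by
    have hP : P.complex.d 1 0 ≫ augmentation P = 0 := P.complex_d_comp_π_f_zero
    rw [Category.assoc, h0, ← Category.assoc, hP, Limits.zero_comp]
  let f1 : P.complex.X 1 ⟶ (resRight f).obj (P'.complex.X 1) :=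
    hex0.liftFromProjective (P.complex.d 1 0 ≫ f0) hz
  have h1 : f1 ≫ (resRight f).map (P'.complex.d 1 0) = P.complex.d 1 0 ≫ f0 :=
    hex0.liftFromProjective_comp _ _
  refine ⟨ChainComplex.mkHom _ _ f0 f1 h1 fun n ⟨a, a', w⟩ =>
    ⟨(hex n).liftFromProjective (P.complex.d (n + 2) (n + 1) ≫ a') ?_,
      (hex n).liftFromProjective_comp _ _⟩, ?_⟩
  · have w' : a' ≫ (resRight f).map (P'.complex.d (n + 1) n) = P.complex.d (n + 1) n ≫ a := w
    refine (Category.assoc _ _ _).trans ((congrArg (P.complex.d (n + 2) (n + 1) ≫ ·) w').trans ?_)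
    exact (Category.assoc _ _ _).symm.trans
      ((congrArg (· ≫ a) (P.complex.d_comp_d _ _ _)).trans Limits.zero_comp)
  · exact h0

/-- The chain map `P ⊗_A N → P' ⊗_A' N'` induced by a chain map over `f : A → A'` and a map
`h : N → N'` that is semilinear over `f`. -/
def tensorComplexMap {P : ChainComplex (ModuleCat.{u} Aᵐᵒᵖ) ℕ}
    {P' : ChainComplex (ModuleCat.{u} A'ᵐᵒᵖ) ℕ} (φ : P ⟶ resComplex f P')
    {N : ModuleCat.{u} A} {N' : ModuleCat.{u} A'} (h : N ⟶ (resLeft f).obj N') :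
    tensorComplex R A P N ⟶ tensorComplex R A' P' N' where
  f i := tensorMap f (φ.f i) h
  comm' i j _ := tensor_hom_ext R A fun m n => by
    change tmk R A' (P'.d i j (φ.f i m)) (h n) = tmk R A' (φ.f j (P.d i j m)) (h n)
    congr 1
    exact congr($(φ.comm i j) m)

/-- The map `Tor_i^A(M, N) → Tor_i^A'(M', N')` induced by an algebra homomorphism `f : A → A'` and
maps `g : M → M'` and `h : N → N'` that are semilinear over `f`. -/
def Tor.map {M : ModuleCat.{u} Aᵐᵒᵖ} {M' : ModuleCat.{u} A'ᵐᵒᵖ} {N : ModuleCat.{u} A}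
    {N' : ModuleCat.{u} A'} (g : M ⟶ (resRight f).obj M') (h : N ⟶ (resLeft f).obj N') (i : ℕ) :
    Tor R A M N i ⟶ Tor R A' M' N' i :=
  HomologicalComplex.homologyMap
    (tensorComplexMap f
      (exists_isLift f g (projectiveResolution M) (projectiveResolution M')).choose h) i

/-- The left `A`-module `R` on which `A` acts through an augmentation. -/
abbrev trivLeft (ε : A →ₐ[R] R) : ModuleCat.{u} A :=
  (ModuleCat.restrictScalars ε.toRingHom).obj (ModuleCat.of R R)

/-- The right `A`-module `R` on which `A` acts through an augmentation. -/
abbrev trivRight (ε : A →ₐ[R] R) : ModuleCat.{u} Aᵐᵒᵖ :=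
  (ModuleCat.restrictScalars (ε.toRingHom.fromOpposite fun _ _ => Commute.all _ _)).obj
    (ModuleCat.of R R)

/-- The identity of `R` as a map of left modules over a homomorphism that respects the
augmentations. -/
def trivLeftMap {ε : A →ₐ[R] R} {ε' : A' →ₐ[R] R} (hf : ε'.comp f = ε) :
    trivLeft ε ⟶ (resLeft f).obj (trivLeft ε') :=
  ModuleCat.ofHom (X := trivLeft ε) (Y := (resLeft f).obj (trivLeft ε'))
    { toFun := fun r => r
      map_add' := fun _ _ => rfl
      map_smul' := fun a r => by
        subst hf; rfl }

/-- The identity of `R` as a map of right modules over a homomorphism that respects the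
augmentations. -/
def trivRightMap {ε : A →ₐ[R] R} {ε' : A' →ₐ[R] R} (hf : ε'.comp f = ε) :
    trivRight ε ⟶ (resRight f).obj (trivRight ε') :=
  ModuleCat.ofHom (X := trivRight ε) (Y := (resRight f).obj (trivRight ε'))
    { toFun := fun r => r
      map_add' := fun _ _ => rfl
      map_smul' := fun a r => by
        subst hf; rfl }

end tensor

noncomputable section homology

open CategoryTheory

variable (R : Type u) [CommRing R] (δ : R) (n i : ℕ)

/-- The homology `H_i(𝔖_n; 𝟙) = Tor_i^{R 𝔖_n}(𝟙, 𝟙)` of the symmetric group. -/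
abbrev symmHomology : ModuleCat.{u} R :=
  Tor R (MonoidAlgebra R (Equiv.Perm (Fin n))) (trivRight (symmAug R n)) (trivLeft (symmAug R n)) i

/-- The homology `Tor_i^{Br_n(R, δ)}(𝟙, 𝟙)` of the Brauer algebra. -/
abbrev brauerHomology : ModuleCat.{u} R :=
  Tor R (BrauerAlgebra R δ n) (trivRight (brauerAug R δ n)) (trivLeft (brauerAug R δ n)) i

/-- The map on homology induced by the inclusion of the group algebra. -/
def inclHomology : symmHomology R n i ⟶ brauerHomology R δ n i :=
  Tor.map (incl R δ n) (trivRightMap _ (brauerAug_comp_incl R δ n))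
    (trivLeftMap _ (brauerAug_comp_incl R δ n)) i

/-- The map on homology induced by the projection to the group algebra. -/
def projHomology : brauerHomology R δ n i ⟶ symmHomology R n i :=
  Tor.map (proj R δ n) (trivRightMap _ (symmAug_comp_proj R δ n))
    (trivLeftMap _ (symmAug_comp_proj R δ n)) i

end homology

end BrauerHomology

/-! Write `A` for the Brauer algebra, `I` for the kernel of `proj`, and `P`, `Q` for the projective
resolutions of the trivial module over `A` and over the group algebra. The comparison `Q → P → Q` is
linear, because `proj` after `incl` is the identity, and it lifts the identity, so it is homotopic
to the identity.

The comparison `P → Q → P` is only semilinear over `incl` after `proj`. This endomorphism of `A` is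
the identity modulo `I`, so the comparison becomes `A`-linear after projecting to `P / P I`. Since
`I` annihilates the trivial module, tensoring with that module turns `P → P / P I` into an
isomorphism. It therefore suffices that the projected comparison and the projection itself are
homotopic. That is the usual uniqueness of lifts, provided `P / P I` is exact in positive degrees,
and this holds once the subcomplex `P I` is exact in all degrees, zero included.
`homologyMap_comp_eq_id` treats both composites at once.

Exactness of `P I` is where `δ` has to be invertible. As a left ideal, `I` is the sum of the left
ideals of diagrams with a prescribed arc on the right. If `N` is the left ideal of diagrams
containing a prescribed list of right arcs, it is zero or has the form `A e` with `e` idempotent,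
`e` being built from the elements `δ⁻¹ • cupCap` (`exists_mul_eq_of_arcSet`). Then `P N = P e` is a
direct summand of `P` as a complex of abelian groups, and its only possible homology is the part of
the trivial module fixed by `e`, which vanishes (`CoeffExact.of_exists_mul_eq`). A Mayer-Vietoris
argument (`CoeffExact.sup`) and an induction over arcs (`coeffExact_arcs`) assemble these pieces
into `I`. -/

namespace BrauerHomology

universe u

/-! ### Homotopies out of complexes of projectives, and composites of semilinear chain maps. -/

noncomputable section comparison

open TensorProduct MulOpposite CategoryTheory

/-- A map from a projective module lifts along `g` as soon as it does so elementwise. -/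
theorem exists_lift_of_forall {S : Type u} [Ring S] {P X Y : ModuleCat.{u} S} [Projective P]
    (f : P ⟶ Y) (g : X ⟶ Y) (h : ∀ p, ∃ x, g x = f p) : ∃ k : P ⟶ X, k ≫ g = f := by
  have : Module.Projective S P := (IsProjective.iff_projective (R := S) P).2 inferInstance
  -- The map `g` need not be surjective, so the lifting is done through its range, which contains
  -- the image of `f`.
  obtain ⟨k, hk⟩ := Module.projective_lifting_property g.hom.rangeRestrict
    (f.hom.codRestrict (LinearMap.range g.hom) h) g.hom.surjective_rangeRestrict
  refine ⟨ModuleCat.ofHom k, ModuleCat.hom_ext (LinearMap.ext fun p => ?_)⟩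
  exact congrArg Subtype.val (LinearMap.congr_fun hk p)

/-- A chain map from a complex of projectives to a complex that is exact in positive degrees is
null-homotopic if it is so in degree zero. -/
theorem nonempty_homotopy_zero {S : Type u} [Ring S] {P X : ChainComplex (ModuleCat.{u} S) ℕ}
    [∀ j, Projective (P.X j)] (e : P ⟶ X)
    (h0 : ∀ p : P.X 0, ∃ x : X.X 1, X.d 1 0 x = e.f 0 p)
    (hX : ∀ j (x : X.X (j + 1)), X.d (j + 1) j x = 0 → ∃ y : X.X (j + 2), X.d (j + 2) (j + 1) y = x) :
    Nonempty (Homotopy e 0) := by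
  obtain ⟨zero, hz⟩ := exists_lift_of_forall (e.f 0) (X.d 1 0) h0
  -- Here `a` is the homotopy built so far. The hypothesis on `t` says that `t - d a` takes values
  -- in cycles, which are boundaries by `hX`.
  have step : ∀ j (a : P.X j ⟶ X.X (j + 1)) (t : P.X (j + 1) ⟶ X.X (j + 1)),
      t ≫ X.d (j + 1) j = P.d (j + 1) j ≫ a ≫ X.d (j + 1) j →
      ∃ k : P.X (j + 1) ⟶ X.X (j + 2), t = P.d (j + 1) j ≫ a + k ≫ X.d (j + 2) (j + 1) := by
    intro j a t ht
    obtain ⟨k, hk⟩ := exists_lift_of_forall (t - P.d (j + 1) j ≫ a) (X.d (j + 2) (j + 1))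
      fun p => hX j _ <| by
        have : (t - P.d (j + 1) j ≫ a) ≫ X.d (j + 1) j = 0 := by
          rw [Preadditive.sub_comp, ht, Category.assoc, sub_self]
        exact congr($this p)
    exact ⟨k, by rw [hk, add_sub_cancel]⟩
  obtain ⟨one, ho⟩ := step 0 zero (e.f 1) (by rw [hz, e.comm])
  refine ⟨Homotopy.mkInductive e zero hz.symm one ho fun j ⟨a, a', w⟩ => ?_⟩
  have := step (j + 1) a' (e.f (j + 2)) (by
    rw [e.comm, w, Preadditive.comp_add, P.d_comp_d_assoc, Limits.zero_comp, zero_add])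
  exact ⟨this.choose, this.choose_spec⟩

variable {R : Type u} [CommRing R] {A : Type u} [Ring A] [Algebra R A]
  {A' : Type u} [Ring A'] [Algebra R A']

/-- A criterion for the composite of two comparison maps to be the identity on homology: the
composite is compared with `q : P → X` for a resolution `X` on which it becomes linear. -/
theorem homologyMap_comp_eq_id (f : A →ₐ[R] A') (f' : A' →ₐ[R] A)
    {P : ChainComplex (ModuleCat.{u} Aᵐᵒᵖ) ℕ} [∀ j, Projective (P.X j)]
    {P' : ChainComplex (ModuleCat.{u} A'ᵐᵒᵖ) ℕ}
    (φ : P ⟶ resComplex f P') (ψ : P' ⟶ resComplex f' P)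
    {N : ModuleCat.{u} A} {N' : ModuleCat.{u} A'} (h : N ⟶ (resLeft f).obj N')
    (h' : N' ⟶ (resLeft f').obj N) (hh : ∀ m : N, (show N from h' (show N' from h m)) = m)
    {X : ChainComplex (ModuleCat.{u} Aᵐᵒᵖ) ℕ} (q : P ⟶ X)
    (hq : ∀ j (a : A) (x : P.X j), q.f j (op (f' (f a)) • x) = op a • q.f j x)
    (h0 : ∀ x : P.X 0, ∃ y : X.X 1,
      X.d 1 0 y = q.f 0 (show P.X 0 from ψ.f 0 (show P'.X 0 from φ.f 0 x)) - q.f 0 x)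
    (hX : ∀ j (x : X.X (j + 1)), X.d (j + 1) j x = 0 → ∃ y : X.X (j + 2), X.d (j + 2) (j + 1) y = x)
    [IsIso (((tensorFunctor R A N).mapHomologicalComplex _).map q)] (i : ℕ) :
    HomologicalComplex.homologyMap (tensorComplexMap f φ h) i ≫
      HomologicalComplex.homologyMap (tensorComplexMap f' ψ h') i = 𝟙 _ := by
  -- The composite of `φ`, `ψ` and `q` is linear over `A`: the first two turn `a` into `f' (f a)`,
  -- and `hq` turns it back into `a`.
  let θ : P ⟶ X :=
    { f := fun j => ModuleCat.ofHom
        { toFun := fun x => q.f j (show P.X j from ψ.f j (show P'.X j from φ.f j x))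
          map_add' := fun x y => by
            refine Eq.trans ?_ (map_add (q.f j).hom _ _)
            refine congrArg (q.f j).hom ?_
            refine Eq.trans ?_ (map_add (ψ.f j).hom _ _)
            exact congrArg (ψ.f j).hom (map_add (φ.f j).hom x y)
          map_smul' := fun a x => by
            refine Eq.trans ?_ (hq j a.unop _)
            refine congrArg (q.f j).hom ?_
            refine Eq.trans ?_ ((ψ.f j).hom.map_smul (op (f a.unop)) _)
            exact congrArg (ψ.f j).hom ((φ.f j).hom.map_smul a x) }
      comm' := fun j k _ => by
        ext x
        have h1 := congr($(φ.comm j k) x)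
        have h2 := congr($(ψ.comm j k) (show P'.X j from φ.f j x))
        have h3 := congr($(q.comm j k) (show P.X j from ψ.f j (show P'.X j from φ.f j x)))
        refine h3.trans (congrArg (q.f k).hom (h2.trans ?_))
        exact congrArg (ψ.f k).hom h1 }
  obtain ⟨H⟩ := nonempty_homotopy_zero (θ - q) h0 hX
  have H' := (((tensorFunctor R A N).mapHomotopy (Homotopy.equivSubZero.symm H)).homologyMap_eq i)
  -- The left side leaves `n` alone and the right side replaces it by `h' (h n)`, which equals `n`
  -- by `hh`.
  have hθ : ((tensorFunctor R A N).mapHomologicalComplex _).map θ =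
      (tensorComplexMap f φ h ≫ tensorComplexMap f' ψ h') ≫
        ((tensorFunctor R A N).mapHomologicalComplex _).map q := by
    ext1 j
    refine tensor_hom_ext R A fun m n => ?_
    change tmk R A _ n = tmk R A _ (show N from h' (show N' from h n))
    rw [hh]
    rfl
  rw [hθ, HomologicalComplex.homologyMap_comp] at H'
  -- The two sides agree after composing with the map induced by `q`, which is an isomorphism on
  -- homology and can be cancelled.
  rw [← HomologicalComplex.homologyMap_comp,
    ← cancel_mono (HomologicalComplex.homologyMap
      (((tensorFunctor R A N).mapHomologicalComplex _).map q) i), H', Category.id_comp]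

end comparison

noncomputable section coefficients

open MulOpposite CategoryTheory

variable {A : Type u} [Ring A]

/-! ### Elements of a right module with coefficients in a left ideal. -/

section modules

variable {M : Type u} [AddCommGroup M] [Module Aᵐᵒᵖ M] {M' : Type u} [AddCommGroup M']
  [Module Aᵐᵒᵖ M']

/-- The elements of a right module on which all functionals take values in the left ideal `N`. For
a projective module `M` this is `M N`. -/
def coeff (M : Type u) [AddCommGroup M] [Module Aᵐᵒᵖ M] (N : Ideal A) : AddSubgroup M where
  carrier := {x | ∀ g : M →ₗ[Aᵐᵒᵖ] Aᵐᵒᵖ, unop (g x) ∈ N}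
  zero_mem' g := by simp
  add_mem' hx hy g := by simpa using N.add_mem (hx g) (hy g)
  neg_mem' hx g := by simpa using hx g

theorem coeff_mono {N N' : Ideal A} (h : N ≤ N') : coeff M N ≤ coeff M N' :=
  fun _ hx g => h (hx g)

theorem map_mem_coeff (f : M →ₗ[Aᵐᵒᵖ] M') {N : Ideal A} {x : M} (hx : x ∈ coeff M N) :
    f x ∈ coeff M' N := fun g => hx (g.comp f)

theorem smul_mem_coeff {N : Ideal A} {a : A} (ha : a ∈ N) (x : M) : op a • x ∈ coeff M N :=
  fun g => by
    rw [map_smul, smul_eq_mul, unop_mul, unop_op]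
    exact N.mul_mem_left _ ha

/-- The description by functionals makes this immediate; for submodules spanned by products it would
be a flatness statement. -/
theorem mem_coeff_inf {N N' : Ideal A} {x : M} (h : x ∈ coeff M N) (h' : x ∈ coeff M N') :
    x ∈ coeff M (N ⊓ N') := fun g => ⟨h g, h' g⟩

variable [Module.Projective Aᵐᵒᵖ M]

/-- A linear section of the canonical surjection from the free module on `M` has coordinates that
are functionals on `M`. Evaluated at `x` they lie in `N`, so `x` belongs to `M N`. -/
theorem exists_sum_of_mem_coeff {N : Ideal A} {x : M} (hx : x ∈ coeff M N) :
    ∃ c : M →₀ Aᵐᵒᵖ, (∀ m, unop (c m) ∈ N) ∧ x = c.sum fun m a => a • m := by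
  obtain ⟨s, hs⟩ := Module.projective_def.1 (inferInstance : Module.Projective Aᵐᵒᵖ M)
  exact ⟨s x, fun m => hx ((Finsupp.lapply m).comp s), (hs x).symm⟩

theorem exists_add_of_mem_coeff_sup {N N' : Ideal A} {x : M} (hx : x ∈ coeff M (N ⊔ N')) :
    ∃ y ∈ coeff M N, ∃ z ∈ coeff M N', x = y + z := by
  obtain ⟨c, hc, rfl⟩ := exists_sum_of_mem_coeff hx
  choose a ha b hb hab using fun m => Submodule.mem_sup.1 (hc m)
  refine ⟨c.sum fun m _ => op (a m) • m, sum_mem fun m _ => smul_mem_coeff (ha m) m,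
    c.sum fun m _ => op (b m) • m, sum_mem fun m _ => smul_mem_coeff (hb m) m, ?_⟩
  rw [← Finsupp.sum_add]
  refine Finset.sum_congr rfl fun m _ => ?_
  change c m • m = op (a m) • m + op (b m) • m
  rw [← add_smul, ← MulOpposite.op_add, hab, op_unop]

/-- In an expansion of `x` with coefficients in `N`, each coefficient is unchanged by right
multiplication by `e`. -/
theorem op_smul_of_mem_coeff {N : Ideal A} {e : A} (he : ∀ a ∈ N, a * e = a) {x : M}
    (hx : x ∈ coeff M N) : op e • x = x := by
  obtain ⟨c, hc, rfl⟩ := exists_sum_of_mem_coeff hx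
  rw [Finsupp.smul_sum]
  refine Finset.sum_congr rfl fun m _ => ?_
  change op e • c m • m = c m • m
  rw [smul_smul]
  congr 1
  exact unop_injective (he _ (hc m))

theorem eq_zero_of_mem_coeff_bot {x : M} (hx : x ∈ coeff M (⊥ : Ideal A)) : x = 0 := by
  have := op_smul_of_mem_coeff (e := (0 : A)) (fun a ha => by simp [(Submodule.mem_bot A).1 ha]) hx
  rw [← this, op_zero, zero_smul]

end modules

/-! ### Exactness of the subcomplexes `P N`. -/

section complexes

variable (P : ChainComplex (ModuleCat.{u} Aᵐᵒᵖ) ℕ)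

/-- The subcomplex `P N` of a complex of right modules is exact. -/
structure CoeffExact (N : Ideal A) : Prop where
  zero : ∀ x ∈ coeff (P.X 0) N, ∃ y ∈ coeff (P.X 1) N, P.d 1 0 y = x
  succ : ∀ j, ∀ x ∈ coeff (P.X (j + 1)) N, P.d (j + 1) j x = 0 →
    ∃ y ∈ coeff (P.X (j + 2)) N, P.d (j + 2) (j + 1) y = x

variable {P} [∀ j, Projective (P.X j)]

instance projective_X (j : ℕ) : Module.Projective Aᵐᵒᵖ (P.X j) :=
  (IsProjective.iff_projective (R := Aᵐᵒᵖ) (P.X j)).2 inferInstance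

theorem CoeffExact.bot : CoeffExact P (⊥ : Ideal A) where
  zero x hx := ⟨0, zero_mem _, by rw [map_zero, eq_zero_of_mem_coeff_bot hx]⟩
  succ j x hx _ := ⟨0, zero_mem _, by rw [map_zero, eq_zero_of_mem_coeff_bot hx]⟩

/-- The Mayer-Vietoris argument. -/
theorem CoeffExact.sup {N N' : Ideal A} (h : CoeffExact P N) (h' : CoeffExact P N')
    (hi : CoeffExact P (N ⊓ N')) : CoeffExact P (N ⊔ N') := by
  -- The connecting map: if `x + x'` is a cycle then `d x = - d x'` has coefficients in both ideals,
  -- so it bounds inside `P (N ⊓ N')`. For `j = 0` this uses exactness in degree zero, where no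
  -- cycle condition is imposed.
  have key : ∀ j, ∀ x ∈ coeff (P.X (j + 1)) N, ∀ x' ∈ coeff (P.X (j + 1)) N',
      P.d (j + 1) j (x + x') = 0 →
      ∃ y ∈ coeff (P.X (j + 1)) (N ⊓ N'), P.d (j + 1) j y = P.d (j + 1) j x := by
    intro j x hx x' hx' hd
    have hxx : P.d (j + 1) j x = - P.d (j + 1) j x' := by
      rw [map_add] at hd
      exact eq_neg_of_add_eq_zero_left hd
    have hm : P.d (j + 1) j x ∈ coeff (P.X j) (N ⊓ N') := by
      refine mem_coeff_inf (map_mem_coeff (P.d (j + 1) j).hom hx) ?_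
      rw [hxx]
      exact neg_mem (map_mem_coeff (P.d (j + 1) j).hom hx')
    rcases j with _ | j
    · exact hi.zero _ hm
    · exact hi.succ j _ hm congr($(P.d_comp_d (j + 2) (j + 1) j) x)
  constructor
  · intro x hx
    obtain ⟨y, hy, z, hz, rfl⟩ := exists_add_of_mem_coeff_sup hx
    obtain ⟨y', hy', rfl⟩ := h.zero y hy
    obtain ⟨z', hz', rfl⟩ := h'.zero z hz
    exact ⟨y' + z', add_mem (coeff_mono le_sup_left hy') (coeff_mono le_sup_right hz'),
      map_add _ _ _⟩
  · intro j x hx hd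
    obtain ⟨y, hy, z, hz, rfl⟩ := exists_add_of_mem_coeff_sup hx
    -- Moving `w` from one summand to the other makes both `y - w` and `z + w` cycles without
    -- changing their sum.
    obtain ⟨w, hw, hwy⟩ := key j y hy z hz hd
    obtain ⟨y', hy', hdy⟩ := h.succ j (y - w) (sub_mem hy (coeff_mono inf_le_left hw))
      (by rw [map_sub, hwy, sub_self])
    obtain ⟨z', hz', hdz⟩ := h'.succ j (z + w) (add_mem hz (coeff_mono inf_le_right hw))
      (by rw [map_add, hwy, add_comm, ← map_add, hd])
    refine ⟨y' + z', add_mem (coeff_mono le_sup_left hy') (coeff_mono le_sup_right hz'), ?_⟩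
    rw [map_add, hdy, hdz]
    abel

/-- Right multiplication by `e` commutes with the differentials and maps `P` onto `P N`, fixing `P
N` pointwise. Hence a boundary in `P N` bounds an element of `P N`, and in degree zero every element
of `P N` is a boundary because `e` kills `M`. -/
theorem CoeffExact.of_exists_mul_eq {M : ModuleCat.{u} Aᵐᵒᵖ} (P : ProjectiveResolution M)
    {N : Ideal A} {e : A} (heN : e ∈ N) (he : ∀ a ∈ N, a * e = a) (hM : ∀ m : M, op e • m = 0) :
    CoeffExact P.complex N := by
  have key : ∀ {X Y : ModuleCat.{u} Aᵐᵒᵖ} [Module.Projective Aᵐᵒᵖ Y] (d : X ⟶ Y), ∀ y ∈ coeff Y N,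
      (∃ x, d x = y) → ∃ x ∈ coeff X N, d x = y := by
    rintro X Y _ d _ hy ⟨x, rfl⟩
    refine ⟨op e • x, smul_mem_coeff heN x, ?_⟩
    rw [map_smul, op_smul_of_mem_coeff he hy]
  constructor
  · intro x hx
    refine key _ x hx (((ShortComplex.moduleCat_exact_iff _).1 P.exact₀) x ?_)
    change (P.π.f 0).hom x = 0
    -- The augmentation sends `x = x e` into `M e`, which is zero.
    rw [← op_smul_of_mem_coeff he hx, map_smul]
    exact hM _
  · intro j x hx hd
    exact key _ x hx (((ShortComplex.moduleCat_exact_iff _).1 (P.exact_succ j)) x hd)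

end complexes

/-! ### The quotient `P / P I` and its tensor products. -/

section quotient

variable (M : Type u) [AddCommGroup M] [Module Aᵐᵒᵖ M] (I : Ideal A) [I.IsTwoSided]

/-- For a two-sided ideal `I` the elements with coefficients in `I` form a submodule. -/
def coeffSubmodule : Submodule Aᵐᵒᵖ M where
  __ := coeff M I
  smul_mem' a x hx g := by
    rw [map_smul, smul_eq_mul, unop_mul]
    exact I.mul_mem_right _ (hx g)

variable (P : ChainComplex (ModuleCat.{u} Aᵐᵒᵖ) ℕ)

/-- The quotient complex `P / P I`. -/
def coeffQuotient : ChainComplex (ModuleCat.{u} Aᵐᵒᵖ) ℕ where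
  X j := ModuleCat.of Aᵐᵒᵖ (P.X j ⧸ coeffSubmodule (P.X j) I)
  d j k := ModuleCat.ofHom <| Submodule.mapQ _ _ (P.d j k).hom
    fun _ hx => map_mem_coeff (P.d j k).hom hx
  shape j k hjk := by
    ext x
    change Submodule.Quotient.mk (P.d j k x) = _
    rw [P.shape j k hjk]
    rfl
  d_comp_d' j k l _ _ := by
    ext x
    change Submodule.Quotient.mk (P.d k l (P.d j k x)) = _
    rw [show P.d k l (P.d j k x) = 0 from congr($(P.d_comp_d j k l) x)]
    rfl

/-- The projection of `P` onto `P / P I`. -/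
def toCoeffQuotient : P ⟶ coeffQuotient I P where
  f j := ModuleCat.ofHom (coeffSubmodule (P.X j) I).mkQ
  comm' _ _ _ := rfl

variable {I P}

theorem toCoeffQuotient_surjective (j : ℕ) : Function.Surjective ((toCoeffQuotient I P).f j) :=
  Submodule.mkQ_surjective _

theorem toCoeffQuotient_eq_iff {j : ℕ} {x y : P.X j} :
    (toCoeffQuotient I P).f j x = (toCoeffQuotient I P).f j y ↔ x - y ∈ coeff (P.X j) I :=
  Submodule.Quotient.eq (coeffSubmodule (P.X j) I)

/-- Used with `a` the image of `b` under `incl` after `proj`: this is what makes a semilinear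
comparison linear on the quotient. -/
theorem toCoeffQuotient_smul {a b : A} (h : a - b ∈ I) (j : ℕ) (x : P.X j) :
    (toCoeffQuotient I P).f j (op a • x) = op b • (toCoeffQuotient I P).f j x := by
  rw [← map_smul, toCoeffQuotient_eq_iff, ← sub_smul, ← MulOpposite.op_sub]
  exact smul_mem_coeff h x

/-- If `P I` is exact then `P / P I` has the same homology as `P`. -/
theorem coeffQuotient_exact (h : CoeffExact P I) {j : ℕ}
    (hP : ∀ x : P.X (j + 1), P.d (j + 1) j x = 0 → ∃ y, P.d (j + 2) (j + 1) y = x)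
    (x : (coeffQuotient I P).X (j + 1)) (hx : (coeffQuotient I P).d (j + 1) j x = 0) :
    ∃ y, (coeffQuotient I P).d (j + 2) (j + 1) y = x := by
  obtain ⟨x, rfl⟩ := toCoeffQuotient_surjective (j + 1) x
  have hx' : P.d (j + 1) j x ∈ coeff (P.X j) I := by
    have h1 : (toCoeffQuotient I P).f j (P.d (j + 1) j x) = (toCoeffQuotient I P).f j 0 :=
      hx.trans (map_zero _).symm
    simpa using toCoeffQuotient_eq_iff.1 h1
  -- Exactness of `P I` corrects the representative `x` by an element of `P I` so that `x - y`
  -- becomes a true cycle of `P`.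
  obtain ⟨y, hy, hyx⟩ : ∃ y ∈ coeff (P.X (j + 1)) I, P.d (j + 1) j y = P.d (j + 1) j x := by
    rcases j with _ | j
    · exact h.zero _ hx'
    · exact h.succ j _ hx' congr($(P.d_comp_d (j + 2) (j + 1) j) x)
  obtain ⟨z, hz⟩ := hP (x - y) (by rw [map_sub, hyx, sub_self])
  refine ⟨(toCoeffQuotient I P).f (j + 2) z, ?_⟩
  change (toCoeffQuotient I P).f (j + 1) (P.d (j + 2) (j + 1) z) = _
  rw [hz, toCoeffQuotient_eq_iff]
  simpa using neg_mem hy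

variable (R : Type u) [CommRing R] [Algebra R A] (N : ModuleCat.{u} A)

theorem tmk_add_right (M : ModuleCat.{u} Aᵐᵒᵖ) (m : M) (n n' : N) :
    tmk R A m (n + n') = tmk R A m n + tmk R A m n' :=
  (congrArg (balanced R A M N).mkQ (TensorProduct.tmul_add _ _ _)).trans (map_add _ _ _)

theorem tmk_smul (M : ModuleCat.{u} Aᵐᵒᵖ) (a : A) (m : M) (n : N) :
    tmk R A (op a • m) n = tmk R A m (a • n) := by
  rw [← sub_eq_zero]
  refine (map_sub (balanced R A M N).mkQ _ _).symm.trans ?_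
  exact (Submodule.Quotient.mk_eq_zero _).2 (Submodule.subset_span ⟨m, a, n, rfl⟩)

theorem smul_tmk (M : ModuleCat.{u} Aᵐᵒᵖ) (r : R) (m : M) (n : N) :
    r • tmk R A m n = tmk R A (op (algebraMap R A r) • m) n :=
  (map_smul (balanced R A M N).mkQ r _).symm

theorem tmk_smul_right (M : ModuleCat.{u} Aᵐᵒᵖ) (r : R) (m : M) (n : N) :
    tmk R A m (algebraMap R A r • n) = r • tmk R A m n :=
  (tmk_smul R N M _ m n).symm.trans (smul_tmk R N M r m n).symm

-- Expand `x` with coefficients in `I` and move each coefficient across the tensor sign, where it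
-- annihilates `N`.
omit [I.IsTwoSided] in
theorem tmk_eq_zero [∀ j, Projective (P.X j)] (hN : ∀ a ∈ I, ∀ n : N, a • n = 0) {j : ℕ}
    {x : P.X j} (hx : x ∈ coeff (P.X j) I) (n : N) : tmk R A x n = 0 := by
  obtain ⟨c, hc, rfl⟩ := exists_sum_of_mem_coeff hx
  let F : P.X j →+ tensorObj R A (P.X j) N :=
    AddMonoidHom.mk' (fun m => tmk R A m n) fun m m' => tmk_add R A m m' n
  change F _ = 0
  rw [Finsupp.sum, map_sum]
  refine Finset.sum_eq_zero fun m _ => ?_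
  refine (tmk_smul R N (P.X j) (unop (c m)) m n).trans ?_
  rw [hN _ (hc m)]
  have h0 := tmk_add_right R N (P.X j) m 0 0
  rw [add_zero] at h0
  exact left_eq_add.1 h0

theorem tmk_eq_of_toCoeffQuotient_eq [∀ j, Projective (P.X j)]
    (hN : ∀ a ∈ I, ∀ n : N, a • n = 0) {j : ℕ} {x y : P.X j}
    (h : (toCoeffQuotient I P).f j x = (toCoeffQuotient I P).f j y) (n : N) :
    tmk R A x n = tmk R A y n := by
  have h1 := tmk_add R A (x - y) y n
  rwa [sub_add_cancel, tmk_eq_zero R N hN (toCoeffQuotient_eq_iff.1 h), zero_add] at h1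

theorem exists_inverse_tensor_toCoeffQuotient [∀ j, Projective (P.X j)]
    (hN : ∀ a ∈ I, ∀ n : N, a • n = 0) (j : ℕ) :
    ∃ k : tensorObj R A ((coeffQuotient I P).X j) N ⟶ tensorObj R A (P.X j) N,
      ∀ (x : P.X j) (n : N), k (tmk R A ((toCoeffQuotient I P).f j x) n) = tmk R A x n := by
  -- The section `s` is merely a function. By `hq`, another choice of representatives gives the same
  -- tensors, and this yields bilinearity and balancedness.
  choose s hs using toCoeffQuotient_surjective (I := I) (P := P) j
  have hq : ∀ (x : P.X j) y n, (toCoeffQuotient I P).f j x = y → tmk R A (s y) n = tmk R A x n :=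
    fun x y n h => tmk_eq_of_toCoeffQuotient_eq R N hN ((hs y).trans h.symm) n
  let B : rightScalars (R := R) A ((coeffQuotient I P).X j) →ₗ[R]
      leftScalars (R := R) A N →ₗ[R] tensorObj R A (P.X j) N :=
    LinearMap.mk₂ R (fun y n => tmk R A (s y) n)
      (fun y y' n => (hq (s y + s y') _ n ((map_add _ _ _).trans (congrArg₂ _ (hs y) (hs y')))).trans (tmk_add R A _ _ n))
      (fun r y n => (hq (op (algebraMap R A r) • s y) _ n
        ((map_smul ((toCoeffQuotient I P).f j).hom _ _).trans (congrArg _ (hs y)))).trans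
        (smul_tmk R N _ r (s y) n).symm)
      (fun y n n' => tmk_add_right R N _ _ n n')
      (fun r y n => tmk_smul_right R N _ r _ n)
  refine ⟨ModuleCat.ofHom (Submodule.liftQ _ (TensorProduct.lift B) ?_), fun x n => hq x _ n rfl⟩
  rw [balanced, Submodule.span_le]
  rintro _ ⟨m, a, n, rfl⟩
  rw [SetLike.mem_coe, LinearMap.mem_ker, map_sub, sub_eq_zero, TensorProduct.lift.tmul,
    TensorProduct.lift.tmul]
  refine (hq (op a • s m) _ n 
    ((map_smul ((toCoeffQuotient I P).f j).hom _ _).trans (congrArg _ (hs m)))).trans ?_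
  exact tmk_smul R N _ a (s m) n

/-- Tensoring over `A` with a module that is annihilated by `I` does not see `P I`. -/
theorem isIso_tensor_toCoeffQuotient [∀ j, Projective (P.X j)] (hN : ∀ a ∈ I, ∀ n : N, a • n = 0) :
    IsIso (((tensorFunctor R A N).mapHomologicalComplex _).map (toCoeffQuotient I P)) := by
  have : ∀ j, IsIso ((((tensorFunctor R A N).mapHomologicalComplex _).map
      (toCoeffQuotient I P)).f j) := by
    intro j
    obtain ⟨k, hk⟩ := exists_inverse_tensor_toCoeffQuotient (I := I) (P := P) R N hN j
    refine ⟨k, tensor_hom_ext R A fun x n => hk x n, tensor_hom_ext R A fun y n => ?_⟩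
    obtain ⟨x, rfl⟩ := toCoeffQuotient_surjective j y
    exact congrArg (((tensorFunctor R A N).map ((toCoeffQuotient I P).f j)).hom) (hk x n)
  exact HomologicalComplex.Hom.isIso_of_components _

end quotient

end coefficients

/-! ### Pasting with the diagram that has one arc `p q` on either side. -/

namespace Diagram

section cupCap

variable {α β : Type} {p q : α}

open Classical in
/-- The diagram with the arc `p q` on either side and horizontal arcs otherwise. -/
noncomputable def cupCap (hpq : p ≠ q) : Diagram α α where
  rel := Setoid.ker (Sum.elim (fun x => if x = p ∨ x = q then Sum.inr false else Sum.inl x)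
    (fun x => if x = p ∨ x = q then Sum.inr true else Sum.inl x) : α ⊕ α → α ⊕ Bool)
  pairs := by
    have hqp := hpq.symm
    rintro (x | x)
    · by_cases h1 : x = p
      · refine ⟨.inl q, ⟨by simp [h1, hqp], by simp [Setoid.ker_def, h1]⟩, ?_⟩
        rintro (y | y) ⟨hy, h⟩ <;> by_cases h2 : y = p <;> by_cases h3 : y = q <;>
          simp_all [Setoid.ker_def]
      by_cases h2 : x = q
      · refine ⟨.inl p, ⟨by simp [h2, hpq], by simp [Setoid.ker_def, h2]⟩, ?_⟩
        rintro (y | y) ⟨hy, h⟩ <;> by_cases h2 : y = p <;> by_cases h3 : y = q <;>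
          simp_all [Setoid.ker_def]
      refine ⟨.inr x, ⟨by simp, by simp [Setoid.ker_def]; simp [h1, h2]⟩, ?_⟩
      rintro (y | y) ⟨hy, h⟩ <;> by_cases h2 : y = p <;> by_cases h3 : y = q <;>
        simp_all [Setoid.ker_def]
    · by_cases h1 : x = p
      · refine ⟨.inr q, ⟨by simp [h1, hqp], by simp [Setoid.ker_def, h1]⟩, ?_⟩
        rintro (y | y) ⟨hy, h⟩ <;> by_cases h2 : y = p <;> by_cases h3 : y = q <;>
          simp_all [Setoid.ker_def]
      by_cases h2 : x = q
      · refine ⟨.inr p, ⟨by simp [h2, hpq], by simp [Setoid.ker_def, h2]⟩, ?_⟩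
        rintro (y | y) ⟨hy, h⟩ <;> by_cases h2 : y = p <;> by_cases h3 : y = q <;>
          simp_all [Setoid.ker_def]
      refine ⟨.inl x, ⟨by simp, by simp [Setoid.ker_def]; simp [h1, h2]⟩, ?_⟩
      rintro (y | y) ⟨hy, h⟩ <;> by_cases h2 : y = p <;> by_cases h3 : y = q <;>
        simp_all [Setoid.ker_def]

theorem cupCap_left (hpq : p ≠ q) : (cupCap hpq).rel (.inl p) (.inl q) :=
  Setoid.ker_def.2 (by simp)

theorem cupCap_right (hpq : p ≠ q) : (cupCap hpq).rel (.inr p) (.inr q) :=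
  Setoid.ker_def.2 (by simp)

theorem cupCap_through (hpq : p ≠ q) {x : α} (hp : x ≠ p) (hq : x ≠ q) :
    (cupCap hpq).rel (.inl x) (.inr x) :=
  Setoid.ker_def.2 (by simp [hp, hq])

/-- Away from `p` and `q` the arcs of `cupCap` are horizontal, so an outer node of the pasted
diagram lies in the component of the corresponding node of `b`. -/
theorem glue_cupCap (hpq : p ≠ q) (b : Diagram β α) {x : β ⊕ α} (hp : x ≠ .inr p)
    (hq : x ≠ .inr q) :
    glue b (cupCap hpq) (Sum.map id Sum.inr x) (Sum.map id Sum.inl x) := by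
  rcases x with x | x
  · exact Setoid.refl' _ _
  · exact Setoid.symm' _ (glue_right b _ (cupCap_through hpq (by simpa using hp) (by simpa using hq)))

/-- The arc `p q` is lost in the middle loop but restored by the right arc of `cupCap`; all other
arcs are prolonged horizontally. By `eq_of_le` one inclusion of relations is enough. -/
theorem comp_cupCap [Finite α] [Finite β] (hpq : p ≠ q) {b : Diagram β α}
    (hb : b.rel (.inr p) (.inr q)) : comp b (cupCap hpq) = b := by
  symm
  refine eq_of_le fun x y hxy => ?_
  have hp : ∀ {y}, b.rel (.inr p) y → y = .inr p ∨ y = .inr q := fun {y} h => by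
    by_cases hy : y = .inr p
    · exact .inl hy
    · exact .inr (b.rel_unique h hb hy (by simpa using hpq.symm))
  have hr := comp_rel_right b (cupCap hpq) (cupCap_right hpq)
  by_cases hx : b.rel (.inr p) x
  · rcases hp hx with rfl | rfl <;> rcases hp (b.rel.trans hx hxy) with rfl | rfl
    · exact Setoid.refl' _ _
    · exact hr
    · exact Setoid.symm' _ hr
    · exact Setoid.refl' _ _
  · have hn : ∀ {z}, b.rel x z → z ≠ .inr p ∧ z ≠ .inr q := by
      refine fun {z} hz => ⟨?_, ?_⟩
      · rintro rfl; exact hx (b.rel.symm hz)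
      · rintro rfl; exact hx (b.rel.trans hb (b.rel.symm hz))
    have h1 := hn (b.rel.refl x)
    have h2 := hn hxy
    exact (glue b _).trans (glue_cupCap hpq b h1.1 h1.2) ((glue b _).trans (glue_left b _ hxy)
      ((glue b _).symm (glue_cupCap hpq b h2.1 h2.2)))

theorem loops_cupCap (hpq : p ≠ q) {b : Diagram β α} (hb : b.rel (.inr p) (.inr q)) :
    loops b (cupCap hpq) = 1 := by
  have hpart : b.partner (.inr p) = .inr q := (b.eq_partner hb (by simpa using hpq.symm)).symm
  have hpart' : b.partner (.inr q) = .inr p :=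
    (b.eq_partner (b.rel.symm hb) (by simpa using hpq)).symm
  have hpart₂ : (cupCap hpq).partner (.inl p) = .inl q :=
    ((cupCap hpq).eq_partner (cupCap_left hpq) (by simpa using hpq.symm)).symm
  have hpart₂' : (cupCap hpq).partner (.inl q) = .inl p :=
    ((cupCap hpq).eq_partner ((cupCap hpq).rel.symm (cupCap_left hpq)) (by simpa using hpq)).symm
  rw [loops, Set.ncard_eq_one]
  refine ⟨{x | glue b (cupCap hpq) x (.inr (.inl p))}, Set.eq_singleton_iff_unique_mem.2
    ⟨⟨⟨_, rfl⟩, fun x hx => ?_⟩, ?_⟩⟩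
  -- The two middle nodes `p` and `q` are swapped by both moves, so they form a whole component.
  · have := glue_min b (cupCap hpq) {.inr (.inl p), .inr (.inl q)}
      (by rintro v (rfl | rfl) <;> simp [leftMove, hpart, hpart'])
      (by rintro v (rfl | rfl) <;> simp [rightMove, hpart₂, hpart₂'])
      _ _ (Setoid.symm' _ hx) (.inl rfl)
    rcases this with rfl | rfl
    · exact ⟨p, rfl⟩
    · exact ⟨q, rfl⟩
  · rintro _ ⟨⟨u, rfl⟩, hC⟩
    obtain ⟨y, rfl⟩ := hC (Setoid.refl' (glue b (cupCap hpq)) u)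
    -- Any other middle node is joined horizontally to a right node, so its component is not a loop.
    have hy : y = p ∨ y = q := by
      by_contra! h
      obtain ⟨z, hz⟩ := hC (show (Sum.inr (Sum.inr y)) ∈ _ from
        Setoid.symm' _ (glue_right b _ (cupCap_through hpq h.1 h.2)))
      cases hz
    rcases hy with rfl | rfl
    · rfl
    · ext x
      have h := glue_right b _ (cupCap_left hpq)
      exact ⟨fun hx => Setoid.trans' _ hx (Setoid.symm' _ h), fun hx => Setoid.trans' _ hx h⟩

/-- If `p q` and `r s` can be arcs of one diagram, then pasting the diagram of `p q` to the right
preserves an arc `r s`. -/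
theorem comp_cupCap_rel [Finite α] [Finite β] (hpq : p ≠ q) {r s : α} (hrs : r ≠ s)
    {b₀ : Diagram β α} (h₁ : b₀.rel (.inr p) (.inr q)) (h₂ : b₀.rel (.inr r) (.inr s))
    {b : Diagram β α} (hb : b.rel (.inr r) (.inr s)) :
    (comp b (cupCap hpq)).rel (.inr r) (.inr s) := by
  -- Two arcs of the matching `b₀` coincide or are disjoint. If they coincide, `cupCap` supplies the
  -- arc `r s`; if they are disjoint, the arc of `b` is carried over horizontally.
  by_cases h : b₀.rel (.inr p) (.inr r)
  · refine comp_rel_right b _ ?_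
    have hp : ∀ {y}, b₀.rel (.inr p) (.inr y) → y = p ∨ y = q := fun {y} h => by
      by_cases hy : y = p
      · exact .inl hy
      · exact .inr (by simpa using b₀.rel_unique h h₁ (by simpa using hy) (by simpa using hpq.symm))
    rcases hp h with rfl | rfl <;> rcases hp (b₀.rel.trans h h₂) with rfl | rfl
    · exact Setoid.refl' _ _
    · exact cupCap_right hpq
    · exact Setoid.symm' _ (cupCap_right hpq)
    · exact Setoid.refl' _ _
  · have hn : ∀ {z}, b₀.rel (.inr r) (.inr z) → (.inr z : β ⊕ α) ≠ .inr p ∧ (.inr z : β ⊕ α) ≠ .inr q := by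
      refine fun {z} hz => ⟨fun e => ?_, fun e => ?_⟩
      · rw [e] at hz; exact h (b₀.rel.symm hz)
      · rw [e] at hz; exact h (b₀.rel.trans h₁ (b₀.rel.symm hz))
    have h3 := hn (b₀.rel.refl _)
    have h4 := hn h₂
    exact (glue b _).trans (glue_cupCap hpq b h3.1 h3.2) ((glue b _).trans (glue_left b _ hb)
      ((glue b _).symm (glue_cupCap hpq b h4.1 h4.2)))

/-- As both sides have equally many nodes, a diagram fails to be a permutation exactly when some
right node is not joined to the left; its partner is then another right node. -/
theorem not_isPermutation_iff [Finite α] (b : Diagram α α) :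
    ¬ b.IsPermutation ↔ ∃ p q, p ≠ q ∧ b.rel (.inr p) (.inr q) := by
  rw [isPermutation_iff_right]
  constructor
  · intro h
    push Not at h
    obtain ⟨y, hy⟩ := h
    rcases hp : b.partner (.inr y) with x | z
    · exact absurd (b.rel.symm (hp ▸ b.rel_partner _)) (hy x)
    · exact ⟨y, z, fun e => b.partner_ne (.inr y) (by rw [hp, e]), hp ▸ b.rel_partner _⟩
  · rintro ⟨p, q, hpq, h⟩ hall
    obtain ⟨x, hx⟩ := hall p
    simpa using b.rel_unique h (b.rel.symm hx) (by simpa using hpq.symm) (by simp)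

end cupCap

end Diagram

/-! ### Left ideals spanned by diagrams. -/

namespace BrauerAlgebra

variable {R : Type u} [CommRing R] {δ : R} {n : ℕ}

/-- The left ideal generated by a set of diagrams. -/
noncomputable def diagIdeal (R : Type u) [CommRing R] (δ : R) {n : ℕ}
    (s : Set (Diagram (Fin n) (Fin n))) : Ideal (BrauerAlgebra R δ n) :=
  Ideal.span (diag δ '' s)

/-- A set of diagrams that is stable under pasting diagrams to the left. -/
def LeftStable (s : Set (Diagram (Fin n) (Fin n))) : Prop :=
  ∀ b, ∀ c ∈ s, Diagram.comp b c ∈ s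

/-- A diagram times a member of `s` is a scalar multiple of a member of `s`, so the `R`-span of `s`
is already a left ideal. -/
theorem LeftStable.mem_diagIdeal {s : Set (Diagram (Fin n) (Fin n))} (hs : LeftStable s)
    {x : BrauerAlgebra R δ n} : x ∈ diagIdeal R δ s ↔ x ∈ Submodule.span R (diag δ '' s) := by
  constructor
  · intro hx
    induction hx using Submodule.span_induction with
    | mem x h => exact Submodule.subset_span h
    | zero => exact zero_mem _
    | add x y _ _ hx hy => exact add_mem hx hy
    | smul a x _ hx =>
      rw [smul_eq_mul]
      induction a using BrauerAlgebra.induction with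
      | ha a a' h h' => rw [add_mul]; exact add_mem h h'
      | hs r a h => rw [smul_mul_assoc]; exact Submodule.smul_mem _ _ h
      | hd b =>
        rename_i hxA; clear hxA
        induction hx using Submodule.span_induction with
        | mem x h =>
          obtain ⟨c, hc, rfl⟩ := h
          rw [diag_mul_diag]
          exact Submodule.smul_mem _ _ (Submodule.subset_span ⟨_, hs b c hc, rfl⟩)
        | zero => rw [mul_zero]; exact zero_mem _
        | add x y _ _ hx hy => rw [mul_add]; exact add_mem hx hy
        | smul r x _ hx => rw [mul_smul_comm]; exact Submodule.smul_mem _ _ hx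
  · intro hx
    induction hx using Submodule.span_induction with
    | mem x h => exact Submodule.subset_span h
    | zero => exact zero_mem _
    | add x y _ _ hx hy => exact add_mem hx hy
    | smul r x _ hx => exact Submodule.smul_of_tower_mem _ r hx

/-- All three ideals are spanned over `R` by subsets of the basis of diagrams, so membership is a
condition on supports. -/
theorem LeftStable.diagIdeal_inter {s t : Set (Diagram (Fin n) (Fin n))} (hs : LeftStable s)
    (ht : LeftStable t) : diagIdeal R δ (s ∩ t) = diagIdeal R δ s ⊓ diagIdeal R δ t := by
  have hst : LeftStable (s ∩ t) := fun b c hc => ⟨hs b c hc.1, ht b c hc.2⟩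
  ext x
  rw [Submodule.mem_inf, hst.mem_diagIdeal, hs.mem_diagIdeal, ht.mem_diagIdeal]
  change x ∈ Submodule.span R (basis R δ n '' _) ↔ x ∈ Submodule.span R (basis R δ n '' _) ∧
    x ∈ Submodule.span R (basis R δ n '' _)
  rw [Module.Basis.mem_span_image, Module.Basis.mem_span_image, Module.Basis.mem_span_image,
    Set.subset_inter_iff]

theorem diagIdeal_union (s t : Set (Diagram (Fin n) (Fin n))) :
    diagIdeal R δ (s ∪ t) = diagIdeal R δ s ⊔ diagIdeal R δ t := by
  rw [diagIdeal, Set.image_union, Ideal.span_union]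
  rfl

theorem diagIdeal_mono {s t : Set (Diagram (Fin n) (Fin n))} (h : s ⊆ t) :
    diagIdeal R δ s ≤ diagIdeal R δ t :=
  Ideal.span_mono (Set.image_mono h)

/-- The diagrams with given arcs on the right. -/
def arcSet (L : List (Fin n × Fin n)) : Set (Diagram (Fin n) (Fin n)) :=
  {b | ∀ t ∈ L, b.rel (.inr t.1) (.inr t.2)}

/-- The diagrams with at least one of the given arcs on the right. -/
def someArcSet (T : List (Fin n × Fin n)) : Set (Diagram (Fin n) (Fin n)) :=
  {b | ∃ t ∈ T, b.rel (.inr t.1) (.inr t.2)}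

theorem leftStable_arcSet (L : List (Fin n × Fin n)) : LeftStable (arcSet L) :=
  fun b c hc t ht => Diagram.comp_rel_right b c (hc t ht)

theorem leftStable_someArcSet (T : List (Fin n × Fin n)) : LeftStable (someArcSet T) := by
  rintro b c ⟨t, ht, h⟩
  exact ⟨t, ht, Diagram.comp_rel_right b c h⟩

theorem arcSet_cons_subset (t : Fin n × Fin n) (L : List (Fin n × Fin n)) :
    arcSet (t :: L) ⊆ arcSet L :=
  fun _ hb s hs => hb s (List.mem_cons_of_mem _ hs)

/-- For invertible `δ` the left ideal of the diagrams with given arcs on the right is generated by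
an idempotent. -/
theorem exists_mul_eq_of_arcSet (hδ : IsUnit δ) {b₀ : Diagram (Fin n) (Fin n)}
    (L : List (Fin n × Fin n)) (hL : ∀ t ∈ L, t.1 ≠ t.2) (h₀ : b₀ ∈ arcSet L) :
    ∃ e ∈ diagIdeal R δ (arcSet L), ∀ x ∈ diagIdeal R δ (arcSet L), x * e = x := by
  induction L with
  | nil =>
    exact ⟨1, Submodule.subset_span ⟨Diagram.ofPerm 1, by simp [arcSet], rfl⟩,
      fun x _ => mul_one x⟩
  | cons p L ih =>
    obtain ⟨e, he, hxe⟩ := ih (fun t ht => hL t (List.mem_cons_of_mem _ ht))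
      (fun t ht => h₀ t (List.mem_cons_of_mem _ ht))
    have hp := hL p List.mem_cons_self
    obtain ⟨v, hv⟩ := hδ.exists_left_inv
    -- Right multiplication by `w` fixes every diagram with the arc `p`: it creates one loop, whose
    -- factor `δ` is cancelled by `v`.
    let w : BrauerAlgebra R δ n := v • diag δ (Diagram.cupCap hp)
    refine ⟨e * w, ?_, fun x hx => ?_⟩
    · rw [(leftStable_arcSet L).mem_diagIdeal] at he
      rw [(leftStable_arcSet _).mem_diagIdeal]
      clear hxe
      induction he using Submodule.span_induction with
      | mem x h =>
        obtain ⟨b, hb, rfl⟩ := h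
        rw [mul_smul_comm, diag_mul_diag]
        refine Submodule.smul_mem _ _ (Submodule.smul_mem _ _ (Submodule.subset_span ⟨_, ?_, rfl⟩))
        intro t ht
        rcases List.mem_cons.1 ht with rfl | htL
        · exact Diagram.comp_rel_right _ _ (Diagram.cupCap_right hp)
        -- The diagram `b` need not contain the arc `p`. Compatibility of `t` with `p` is read off
        -- from `b₀`, which contains both.
        · exact Diagram.comp_cupCap_rel hp (hL t ht) (h₀ p List.mem_cons_self) (h₀ t ht) (hb t htL)
      | zero => rw [zero_mul]; exact zero_mem _
      | add x y _ _ hx hy => rw [add_mul]; exact add_mem hx hy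
      | smul r x _ hx => rw [smul_mul_assoc]; exact Submodule.smul_mem _ _ hx
    · rw [← mul_assoc, hxe x (diagIdeal_mono (arcSet_cons_subset p L) hx)]
      rw [(leftStable_arcSet _).mem_diagIdeal] at hx
      induction hx using Submodule.span_induction with
      | mem x h =>
        obtain ⟨b, hb, rfl⟩ := h
        have hbp := hb p List.mem_cons_self
        rw [mul_smul_comm, diag_mul_diag, Diagram.loops_cupCap hp hbp, Diagram.comp_cupCap hp hbp,
          pow_one, smul_smul, hv, one_smul]
      | zero => rw [zero_mul]
      | add x y _ _ hx hy => rw [add_mul, hx, hy]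
      | smul r x _ hx => rw [smul_mul_assoc, hx]

theorem brauerAug_of_mem_diagIdeal {s : Set (Diagram (Fin n) (Fin n))}
    (hs : ∀ b ∈ s, ¬ b.IsPermutation) {x : BrauerAlgebra R δ n} (hx : x ∈ diagIdeal R δ s) :
    brauerAug R δ n x = 0 := by
  have : diagIdeal R δ s ≤ RingHom.ker (brauerAug R δ n) := by
    rw [diagIdeal, Ideal.span_le]
    rintro _ ⟨b, hb, rfl⟩
    rw [SetLike.mem_coe, RingHom.mem_ker, brauerAug_diag, if_neg (hs b hb)]
  exact this hx

theorem proj_comp_incl (a : MonoidAlgebra R (Equiv.Perm (Fin n))) :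
    proj R δ n (incl R δ n a) = a := by
  have : (proj R δ n).comp (incl R δ n) = AlgHom.id R _ := by
    refine MonoidAlgebra.algHom_ext (fun σ => ?_) (Subsingleton.elim _ _)
    rw [AlgHom.comp_apply, incl_single, proj_diag, projDiagram_ofPerm]
    rfl
  exact DFunLike.congr_fun this a

/-- The difference vanishes on permutation diagrams and is the diagram itself otherwise. -/
theorem sub_incl_proj_mem (x : BrauerAlgebra R δ n) :
    x - incl R δ n (proj R δ n x) ∈ diagIdeal R δ {b | ¬ b.IsPermutation} := by
  induction x using BrauerAlgebra.induction with
  | ha x y h h' =>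
    rw [map_add, map_add, add_sub_add_comm]
    exact add_mem h h'
  | hs r x h =>
    rw [map_smul, map_smul, ← smul_sub]
    exact Submodule.smul_of_tower_mem _ r h
  | hd b =>
    by_cases hb : b.IsPermutation
    · obtain ⟨σ, rfl⟩ := Diagram.exists_perm hb
      rw [proj_diag, projDiagram_ofPerm, incl_single, sub_self]
      exact zero_mem _
    · rw [proj_diag, projDiagram, dif_neg hb, map_zero, sub_zero]
      exact Submodule.subset_span ⟨b, hb, rfl⟩

theorem ker_proj : RingHom.ker (proj R δ n) = diagIdeal R δ {b | ¬ b.IsPermutation} := by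
  refine le_antisymm (fun x hx => ?_) ?_
  · have h := sub_incl_proj_mem x
    rwa [RingHom.mem_ker.1 hx, map_zero, sub_zero] at h
  · rw [diagIdeal, Ideal.span_le]
    rintro _ ⟨b, hb, rfl⟩
    rw [SetLike.mem_coe, RingHom.mem_ker, proj_diag, projDiagram, dif_neg hb]

open CategoryTheory

/-- Carrying the list `L` of imposed arcs keeps the family closed under the intersections that
Mayer-Vietoris produces: splitting off `t` from `T` leaves the ideal of the arcs `t :: L` and an
intersection that is again of the same form with `T` shorter. -/
theorem coeffExact_arcs (hδ : IsUnit δ) (P : ProjectiveResolution (trivRight (brauerAug R δ n)))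
    (T L : List (Fin n × Fin n)) (hT : ∀ t ∈ T, t.1 ≠ t.2) (hL : ∀ t ∈ L, t.1 ≠ t.2) :
    CoeffExact P.complex (diagIdeal R δ (arcSet L ∩ someArcSet T)) := by
  have hempty : ∀ s : Set (Diagram (Fin n) (Fin n)), s = ∅ →
      CoeffExact P.complex (diagIdeal R δ s) := by
    rintro _ rfl
    rw [diagIdeal, Set.image_empty, Ideal.span_empty]
    exact CoeffExact.bot
  induction T generalizing L with
  | nil => exact hempty _ (by simp [someArcSet])
  | cons t T ih =>
    have hT' : ∀ t ∈ T, t.1 ≠ t.2 := fun s hs => hT s (List.mem_cons_of_mem _ hs)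
    have htL : ∀ s ∈ t :: L, s.1 ≠ s.2 :=
      List.forall_mem_cons.2 ⟨hT t List.mem_cons_self, hL⟩
    have hunion : arcSet L ∩ someArcSet (t :: T) =
        (arcSet L ∩ someArcSet T) ∪ arcSet (t :: L) := by
      ext b
      simp only [arcSet, someArcSet, Set.mem_inter_iff, Set.mem_union, Set.mem_ofPred_eq,
        List.mem_cons, forall_eq_or_imp, exists_eq_or_imp]
      rw [and_or_left, or_comm]
      exact or_congr Iff.rfl and_comm
    have hinter : (arcSet L ∩ someArcSet T) ∩ arcSet (t :: L) =
        arcSet (t :: L) ∩ someArcSet T := by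
      ext b
      simp only [arcSet, someArcSet, Set.mem_inter_iff, Set.mem_ofPred_eq, List.forall_mem_cons]
      tauto
    rw [hunion, diagIdeal_union]
    refine (ih L hT' hL).sup ?_ ?_
    -- Incompatible arcs give the zero ideal. Otherwise any diagram containing them all certifies
    -- compatibility and the ideal has an idempotent generator.
    · rcases (arcSet (t :: L)).eq_empty_or_nonempty with h | ⟨b₀, h₀⟩
      · exact hempty _ h
      · obtain ⟨e, he, hxe⟩ := exists_mul_eq_of_arcSet hδ (t :: L) htL h₀
        refine CoeffExact.of_exists_mul_eq P he hxe fun m => ?_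
        change brauerAug R δ n e * (show R from m) = 0
        rw [brauerAug_of_mem_diagIdeal (fun b hb => ?_) he, zero_mul]
        exact b.not_isPermutation_iff.2
          ⟨t.1, t.2, htL t List.mem_cons_self, hb t List.mem_cons_self⟩
    · rw [← LeftStable.diagIdeal_inter _ (leftStable_arcSet _), hinter]
      · exact ih (t :: L) hT' htL
      · exact fun b c hc => ⟨leftStable_arcSet L b c hc.1, leftStable_someArcSet T b c hc.2⟩

/-- For invertible `δ` the ideal of the non-permutation diagrams is homologically invisible to the
trivial module. -/
theorem coeffExact_ker_proj (hδ : IsUnit δ)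
    (P : ProjectiveResolution (trivRight (brauerAug R δ n))) :
    CoeffExact P.complex (RingHom.ker (proj R δ n)) := by
  -- Each arc is listed in both orientations; the induction allows repeated arcs.
  let T : List (Fin n × Fin n) := (Finset.univ.filter fun t : Fin n × Fin n => t.1 ≠ t.2).toList
  have hT : ∀ t, t ∈ T ↔ t.1 ≠ t.2 := fun t => by simp [T]
  have h := coeffExact_arcs hδ P T [] (fun t ht => (hT t).1 ht) (by simp)
  have hset : arcSet [] ∩ someArcSet T = {b | ¬ b.IsPermutation} := by
    ext b
    rw [Set.mem_ofPred_eq, b.not_isPermutation_iff]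
    simp [arcSet, someArcSet, hT]
  rwa [hset, ← ker_proj] at h

end BrauerAlgebra

/-! ### Augmentations, and the two composites on homology. -/

section

open CategoryTheory MulOpposite

variable {R : Type u} [CommRing R] {A : Type u} [Ring A] [Algebra R A]
  {A' : Type u} [Ring A'] [Algebra R A']

theorem augmentation_of_isLift {f : A →ₐ[R] A'} {ε : A →ₐ[R] R} {ε' : A' →ₐ[R] R}
    (hf : ε'.comp f = ε) {P : ProjectiveResolution (trivRight ε)}
    {P' : ProjectiveResolution (trivRight ε')} {φ : P.complex ⟶ resComplex f P'.complex}
    (h : IsLift f (trivRightMap f hf) P P' φ) (x : P.complex.X 0) :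
    (show R from augmentation P' (show P'.complex.X 0 from φ.f 0 x)) = augmentation P x :=
  congr($h x)

/-- This provides the degree-zero start of the homotopies, since lifts preserve the augmentation. -/
theorem exists_of_augmentation_eq {M : ModuleCat.{u} Aᵐᵒᵖ} (P : ProjectiveResolution M)
    {x y : P.complex.X 0} (h : augmentation P x = augmentation P y) :
    ∃ z, P.complex.d 1 0 z = x - y := by
  refine ((ShortComplex.moduleCat_exact_iff _).1 P.exact₀) (x - y) ?_
  change augmentation P (x - y) = 0
  rw [map_sub, h, sub_self]

end

end BrauerHomology

open CategoryTheory in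
theorem theoremA {R : Type*} [CommRing R] (δ : R) (hδ : IsUnit δ) (n i : ℕ) :
    BrauerHomology.inclHomology R δ n i ≫ BrauerHomology.projHomology R δ n i = 𝟙 _ ∧
      BrauerHomology.projHomology R δ n i ≫ BrauerHomology.inclHomology R δ n i = 𝟙 _ := by
  open BrauerHomology BrauerAlgebra in
  let P := projectiveResolution (trivRight (brauerAug R δ n))
  let Q := projectiveResolution (trivRight (symmAug R n))
  -- `Tor.map` is defined through chosen lifts; only their compatibility with the augmentations is
  -- needed.
  have hφ := (exists_isLift (proj R δ n) (trivRightMap _ (symmAug_comp_proj R δ n)) P Q).choose_spec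
  have hψ := (exists_isLift (incl R δ n) (trivRightMap _ (brauerAug_comp_incl R δ n)) Q P).choose_spec
  constructor
  -- On the side of the symmetric group the criterion applies with `X = Q` and the identity for `q`.
  · refine homologyMap_comp_eq_id (incl R δ n) (proj R δ n) _ _ _ _ (fun _ => rfl)
      (𝟙 Q.complex) (fun j a x => ?_) (fun x => ?_)
      (fun j => (ShortComplex.moduleCat_exact_iff _).1 (Q.exact_succ j)) i
    · rw [proj_comp_incl]
      rfl
    · refine exists_of_augmentation_eq Q ?_
      exact (augmentation_of_isLift _ hφ _).trans (augmentation_of_isLift _ hψ x)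
  · have hI := coeffExact_ker_proj hδ P
    have := isIso_tensor_toCoeffQuotient (I := RingHom.ker (proj R δ n)) (P := P.complex) R
      (trivLeft (brauerAug R δ n)) (fun a ha r => by
        change brauerAug R δ n a * (show R from r) = 0
        rw [ker_proj] at ha
        rw [brauerAug_of_mem_diagIdeal (fun _ hb => hb) ha, zero_mul])
    -- On the Brauer side the comparison is linear only modulo the kernel of `proj`, so `X` is the
    -- quotient complex of `P`.
    refine homologyMap_comp_eq_id (proj R δ n) (incl R δ n) _ _ _ _ (fun _ => rfl)
      (toCoeffQuotient (RingHom.ker (proj R δ n)) P.complex) (fun j a x => ?_) (fun x => ?_)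
      (fun j => coeffQuotient_exact hI ((ShortComplex.moduleCat_exact_iff _).1 (P.exact_succ j))) i
    · refine toCoeffQuotient_smul ?_ j x
      rw [RingHom.mem_ker, map_sub, proj_comp_incl, sub_self]
    · obtain ⟨z, hz⟩ := exists_of_augmentation_eq P
        ((augmentation_of_isLift _ hψ _).trans (augmentation_of_isLift _ hφ x))
      refine ⟨(toCoeffQuotient _ P.complex).f 1 z, ?_⟩
      rw [← map_sub, ← hz]
      rfl
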